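/- Let $\mathbb T=\mathbb R/L\mathbb Z$ with $L>0$, let $s\ge 1$, and let $H^r(\mathbb T)$ be the usual complex $L^2$-based Sobolev spaces. Let $\boldsymbol\mu=\bigotimes_{j\ge1}\mathcal N(0,1)$ be the product Gaussian measure on $U=\mathbb R^{\mathbb N}$, and let $\lambda_1\ge\lambda_2\ge\dots>0$. Assume the following. 1. $\psi_{\mathrm{in}}\in H^s(\mathbb T)$; $v_0\in H^s(\mathbb T)$ and $v_j\in H^s(\mathbb T)\cap W^{1,\infty}(\mathbb T)$ $(j\ge1)$ are real-valued; and $G$ is a bounded linear functional on $H^1(\mathbb T)$. 2. $\sum_{j\ge1}\lambda_j\|v_j\|_{H^s(\mathbb T)}<\infty$, and $\sum_{j\ge1}\bigl(\lambda_j\|v_j\|_{W^{1,\infty}(\mathbb T)}\bigr)^p<\infty$ for some $p\in(0,1]$. 3. With $V(\boldsymbol\xi)=v_0+\sum_{j=1}^\infty\lambda_j\xi_jv_j$ (the series converges in $H^1(\mathbb T)$ for $\boldsymbol\mu$-a.e. $\boldsymbol\xi$) and $V_m(\boldsymbol\xi)=v_0+\sum_{j=1}^m\lambda_j\xi_jv_j$,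 there are constants $C_0,\varepsilon,\chi>0$ such that for all integers $m\ge1$ $$\Bigl(\int_U\|V_m(\boldsymbol\xi)-V(\boldsymbol\xi)\|_{H^1(\mathbb T)}^{2+\varepsilon}\,d\boldsymbol\mu(\boldsymbol\xi)\Bigr)^{1/(2+\varepsilon)}\le C_0m^{-\chi}.$$ Consider the Schrödinger equations $$i\partial_t\psi=-\tfrac12\partial_x^2\psi+V(\boldsymbol\xi)\psi,\qquad i\partial_t\psi_m=-\tfrac12\partial_x^2\psi_m+V_m(\boldsymbol\xi)\psi_m,\qquad \psi(0)=\psi_m(0)=\psi_{\mathrm{in}},$$ understood as Duhamel's formula $$\psi(t)=e^{it\partial_x^2/2}\psi_{\mathrm{in}}-i\int_0^te^{i(t-\rho)\partial_x^2/2}\bigl(V\psi(\rho)\bigr)\,d\rho\quad(t\ge0),\qquad \psi\in C([0,\infty),H^1(\mathbb T)),$$ and likewise for $\psi_m$ with $V_m$. For $\boldsymbol\mu$-a.e. $\boldsymbol\xi\in U$ these equations (for $V$ and for every $V_m$, $m\ge1$) have unique solutions $\psi(\cdot,\boldsymbol\xi)$ and $\psi_m(\cdot,\boldsymbol\xi)$.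 For every $T>0$ there is a constant $C>0$ independent of $m$ such that, for all integers $m\ge1$, $\psi_m-\psi\in L^2_{\boldsymbol\mu}(U,L^\infty((0,T),H^1(\mathbb T)))$ and $$\|\psi_m-\psi\|_{L^2_{\boldsymbol\mu}(U,L^\infty((0,T),H^1(\mathbb T)))}=\Bigl(\int_U\|\psi_m(\cdot,\boldsymbol\xi)-\psi(\cdot,\boldsymbol\xi)\|_{L^\infty((0,T),H^1(\mathbb T))}^2\,d\boldsymbol\mu(\boldsymbol\xi)\Bigr)^{1/2}\le Cm^{-\chi}.$$ Consequently, for every $T>0$ there is a constant $C>0$ independent of $m$ and $t$ such that, for all integers $m\ge1$ and all $t\in[0,T]$, the random variables $G(|\psi(t)|^2)$ and $G(|\psi_m(t)|^2)$ are $\boldsymbol\mu$-integrable and $$\bigl|\mathbb E[G(|\psi(t)|^2)]-\mathbb E[G(|\psi_m(t)|^2)]\bigr|\le Cm^{-\chi}.$$ -/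

import Mathlib

open MeasureTheory ProbabilityTheory Filter Topology
open scoped ENNReal

noncomputable section

namespace RandomSchrodinger

/-- The Lebesgue space `L²(𝕋)` of the torus `𝕋 = ℝ / Lℤ`, for the Haar measure of total mass one. -/
abbrev L2T (L : ℝ) [Fact (0 < L)] : Type :=
  Lp ℂ 2 (AddCircle.haarAddCircle (T := L))

/-- The frequency `2πk / L` of the `k`-th Fourier mode on `ℝ / Lℤ`. -/
def freq (L : ℝ) (k : ℤ) : ℝ := 2 * Real.pi * k / L

/-- The Sobolev weight `(1 + (2πk/L)²) ^ (s/2)`. -/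
def weight (L s : ℝ) (k : ℤ) : ℝ := (1 + freq L k ^ 2) ^ (s / 2)

lemma weight_pos (L s : ℝ) (k : ℤ) : 0 < weight L s k :=
  Real.rpow_pos_of_pos (by positivity) _

lemma weight_mono (L : ℝ) {r s : ℝ} (h : r ≤ s) (k : ℤ) : weight L r k ≤ weight L s k :=
  Real.rpow_le_rpow_of_exponent_le (by nlinarith [sq_nonneg (freq L k)]) (by linarith)

lemma weight_one_sq (L : ℝ) (k : ℤ) : weight L 1 k ^ 2 = 1 + freq L k ^ 2 := by
  unfold weight
  rw [← Real.sqrt_eq_rpow, Real.sq_sqrt (by positivity)]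

section

variable {L : ℝ} [Fact (0 < L)]

lemma fourierCoeff_add' (f g : L2T L) (k : ℤ) :
    fourierCoeff (f + g : L2T L) k = fourierCoeff f k + fourierCoeff g k := by
  simp only [← fourierBasis_repr, map_add, lp.coeFn_add, Pi.add_apply]

lemma fourierCoeff_smul' (c : ℂ) (f : L2T L) (k : ℤ) :
    fourierCoeff (c • f : L2T L) k = c * fourierCoeff f k := by
  simp only [← fourierBasis_repr, map_smul, lp.coeFn_smul, Pi.smul_apply, smul_eq_mul]

lemma fourierCoeff_zero' (k : ℤ) : fourierCoeff (0 : L2T L) k = 0 := by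
  simp only [← fourierBasis_repr, map_zero, lp.coeFn_zero, Pi.zero_apply]

lemma l2_ext {f g : L2T L} (h : ∀ k, fourierCoeff f k = fourierCoeff g k) : f = g := by
  apply fourierBasis.repr.injective
  ext k
  simpa only [fourierBasis_repr] using h k

end

lemma memℓp_two_of_le {a b : ℤ → ℂ} (hb : Memℓp b 2) (h : ∀ k, ‖a k‖ ≤ ‖b k‖) : Memℓp a 2 := by
  rw [memℓp_gen_iff (by norm_num)] at hb ⊢
  exact hb.of_nonneg_of_le (fun k => by positivity)
    fun k => Real.rpow_le_rpow (norm_nonneg _) (h k) (by norm_num)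

/-- The Sobolev space `H^s(𝕋)` as a set of functions: those `f ∈ L²(𝕋)` with
`∑ₖ (1 + (2πk/L)²)^s |f̂(k)|² < ∞`. -/
def sobolevSubmodule (L : ℝ) [Fact (0 < L)] (s : ℝ) : Submodule ℂ (L2T L) where
  carrier := {f | Memℓp (fun k : ℤ => (weight L s k : ℂ) * fourierCoeff f k) 2}
  add_mem' := by
    intro f g hf hg
    have := Memℓp.add hf hg
    refine (congrArg (fun F => Memℓp F 2) ?_).mp this
    funext k
    simp only [Pi.add_apply, ← mul_add]
    exact congrArg _ (fourierCoeff_add' f g k).symm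
  zero_mem' := by
    refine (congrArg (fun F => Memℓp F 2) ?_).mp (zero_memℓp (E := fun _ : ℤ => ℂ))
    funext k
    simp only [fourierCoeff_zero', mul_zero, Pi.zero_apply]
  smul_mem' := by
    intro c f hf
    have := Memℓp.const_smul hf c
    refine (congrArg (fun F => Memℓp F 2) ?_).mp this
    funext k
    simp only [fourierCoeff_smul', Pi.smul_apply, smul_eq_mul]
    ring

/-- The Sobolev space `H^s(𝕋)`, as a type of its own since it carries the `H^s` norm and not the
`L²` norm. -/
def Sobolev (L : ℝ) [Fact (0 < L)] (s : ℝ) : Type := sobolevSubmodule L s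

namespace Sobolev

variable {L : ℝ} [Fact (0 < L)] {r s : ℝ}

instance : AddCommGroup (Sobolev L s) := inferInstanceAs (AddCommGroup (sobolevSubmodule L s))

instance : Module ℂ (Sobolev L s) := inferInstanceAs (Module ℂ (sobolevSubmodule L s))

/-- The inclusion `H^s(𝕋) → L²(𝕋)`. -/
def toL2 : Sobolev L s →ₗ[ℂ] L2T L := (sobolevSubmodule L s).subtype

lemma toL2_mem (f : Sobolev L s) : f.toL2 ∈ sobolevSubmodule L s := Subtype.property f

lemma toL2_injective : Function.Injective (toL2 : Sobolev L s → L2T L) := Subtype.val_injective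

/-- A function representing an element of `H^s(𝕋)`, unique up to null sets. -/
instance : CoeFun (Sobolev L s) (fun _ => AddCircle L → ℂ) := ⟨fun f => (f.toL2 : L2T L)⟩

/-- An element of `H^s(𝕋)` from an `L²` function with finite `H^s` norm. -/
def mk (f : L2T L) (hf : f ∈ sobolevSubmodule L s) : Sobolev L s := ⟨f, hf⟩

@[simp] lemma toL2_mk (f : L2T L) (hf : f ∈ sobolevSubmodule L s) : (mk f hf).toL2 = f := rfl

/-- The sequence `(1 + (2πk/L)²)^(s/2) f̂(k)`, which is square summable. -/
def toSeq : Sobolev L s →ₗ[ℂ] lp (fun _ : ℤ => ℂ) 2 where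
  toFun f := ⟨fun k => (weight L s k : ℂ) * fourierCoeff f k, f.toL2_mem⟩
  map_add' f g := by
    ext k
    simp only [map_add, lp.coeFn_add, Pi.add_apply, ← mul_add]
    exact congrArg _ (fourierCoeff_add' f.toL2 g.toL2 k)
  map_smul' c f := by
    ext k
    simp only [map_smul, fourierCoeff_smul', RingHom.id_apply, lp.coeFn_smul, Pi.smul_apply,
      smul_eq_mul]
    ring

lemma toSeq_apply (f : Sobolev L s) (k : ℤ) :
    toSeq f k = (weight L s k : ℂ) * fourierCoeff f k := rfl

lemma toSeq_injective : Function.Injective (toSeq : Sobolev L s → lp (fun _ : ℤ => ℂ) 2) := by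
  intro f g h
  apply toL2_injective
  apply l2_ext
  intro k
  have hk : toSeq f k = toSeq g k := by rw [h]
  rw [toSeq_apply, toSeq_apply] at hk
  exact mul_left_cancel₀ (by exact_mod_cast (weight_pos L s k).ne') hk

/-- The `H^s` norm, `‖f‖² = ∑ₖ (1 + (2πk/L)²)^s |f̂(k)|²`. -/
instance : NormedAddCommGroup (Sobolev L s) :=
  NormedAddCommGroup.induced (Sobolev L s) (lp (fun _ : ℤ => ℂ) 2) toSeq toSeq_injective

instance : NormedSpace ℂ (Sobolev L s) :=
  NormedSpace.induced ℂ (Sobolev L s) (lp (fun _ : ℤ => ℂ) 2) toSeq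

lemma norm_eq_norm_toSeq (f : Sobolev L s) : ‖f‖ = ‖toSeq f‖ := rfl

lemma norm_sq_eq_tsum (f : Sobolev L s) :
    ‖f‖ ^ 2 = ∑' k : ℤ, (1 + freq L k ^ 2) ^ s * ‖fourierCoeff f k‖ ^ 2 := by
  have h := lp.norm_rpow_eq_tsum (p := 2) (by norm_num) (toSeq f)
  norm_num at h
  rw [norm_eq_norm_toSeq, h]
  refine tsum_congr fun k => ?_
  rw [toSeq_apply, norm_mul, mul_pow, Complex.norm_real, Real.norm_of_nonneg (weight_pos L s k).le]
  congr 1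
  rw [weight, ← Real.rpow_natCast, ← Real.rpow_mul (by positivity)]
  congr 1
  push_cast
  ring

lemma mem_of_le (h : r ≤ s) (f : Sobolev L s) : f.toL2 ∈ sobolevSubmodule L r := by
  have hf := f.toL2_mem
  refine memℓp_two_of_le (b := fun k : ℤ => (weight L s k : ℂ) * fourierCoeff f k) hf ?_
  · intro k
    simp only [norm_mul, Complex.norm_real, Real.norm_of_nonneg (weight_pos L _ k).le]
    exact mul_le_mul_of_nonneg_right (weight_mono L h k) (norm_nonneg _)

/-- The inclusion `H^s(𝕋) → H^r(𝕋)` for `r ≤ s`: the same function. -/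
def incl (h : r ≤ s) (f : Sobolev L s) : Sobolev L r := mk f.toL2 (mem_of_le h f)

/-- The element of `H^s(𝕋)` is a real-valued function. -/
def IsReal (f : Sobolev L s) : Prop :=
  ∀ᵐ x ∂(AddCircle.haarAddCircle (T := L)), (f x).im = 0

end Sobolev

section

variable {L : ℝ} [Fact (0 < L)]

lemma mem_sobolevSubmodule_iff (s : ℝ) (f : L2T L) :
    f ∈ sobolevSubmodule L s ↔ Memℓp (fun k : ℤ => (weight L s k : ℂ) * fourierCoeff f k) 2 :=
  Iff.rfl

lemma exists_fourierCoeff_eq {a : ℤ → ℂ} (ha : Memℓp a 2) :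
    ∃ f : L2T L, ∀ k, fourierCoeff f k = a k := by
  refine ⟨fourierBasis.repr.symm ⟨a, ha⟩, fun k => ?_⟩
  rw [← fourierBasis_repr, LinearIsometryEquiv.apply_symm_apply]

lemma memℓp_fourierCoeff (f : L2T L) : Memℓp (fun k : ℤ => fourierCoeff f k) 2 := by
  have := (fourierBasis.repr f).2
  refine (congrArg (fun F => Memℓp F 2) ?_).mp this
  funext k
  exact fourierBasis_repr f k

lemma memℓp_two_iff {a : ℤ → ℂ} : Memℓp a 2 ↔ Summable fun k => ‖a k‖ ^ 2 := by
  rw [memℓp_gen_iff (by norm_num)]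
  norm_num

lemma summable_sq_fourierCoeff (f : L2T L) : Summable fun k : ℤ => ‖fourierCoeff f k‖ ^ 2 :=
  memℓp_two_iff.mp (memℓp_fourierCoeff f)

/-- Membership in `H¹` means that `i (2πk/L) f̂(k)` are the Fourier coefficients of an `L²` function,
the weak derivative. -/
lemma mem_one_iff (f : L2T L) : f ∈ sobolevSubmodule L 1 ↔
    ∃ g : L2T L, ∀ k, fourierCoeff g k = Complex.I * freq L k * fourierCoeff f k := by
  have key : ∀ k, ‖(weight L 1 k : ℂ) * fourierCoeff f k‖ ^ 2 =
      ‖fourierCoeff f k‖ ^ 2 + ‖Complex.I * freq L k * fourierCoeff f k‖ ^ 2 := by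
    intro k
    simp only [norm_mul, mul_pow, Complex.norm_real, Complex.norm_I, Real.norm_eq_abs, sq_abs,
      weight_one_sq]
    ring
  rw [mem_sobolevSubmodule_iff, memℓp_two_iff]
  simp_rw [key]
  constructor
  · intro h
    have h2 : Summable fun k : ℤ => ‖Complex.I * freq L k * fourierCoeff f k‖ ^ 2 := by
      simpa using h.sub (summable_sq_fourierCoeff f)
    exact exists_fourierCoeff_eq (memℓp_two_iff.mpr h2)
  · rintro ⟨g, hg⟩
    simp_rw [← hg]
    exact (summable_sq_fourierCoeff f).add (summable_sq_fourierCoeff g)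

instance Sobolev.instCompleteSpaceOne : CompleteSpace (Sobolev L 1) := by
  have hs : Function.Surjective (Sobolev.toSeq : Sobolev L 1 → lp (fun _ : ℤ => ℂ) 2) := by
    intro a
    have ha : Memℓp (fun k : ℤ => ((weight L 1 k : ℂ))⁻¹ * a k) 2 := by
      refine memℓp_two_of_le (b := fun k : ℤ => a k) a.2 fun k => ?_
      rw [norm_mul, norm_inv, Complex.norm_real, Real.norm_of_nonneg (weight_pos L _ k).le]
      have h1 : 1 ≤ weight L 1 k := by
        have := weight_one_sq L k
        nlinarith [weight_pos L 1 k, sq_nonneg (freq L k)]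
      calc (weight L 1 k)⁻¹ * ‖a k‖ ≤ 1 * ‖a k‖ :=
            mul_le_mul_of_nonneg_right (inv_le_one_of_one_le₀ h1) (norm_nonneg _)
        _ = ‖a k‖ := one_mul _
    obtain ⟨f, hf⟩ := exists_fourierCoeff_eq (L := L) ha
    have hw : ∀ k, (weight L 1 k : ℂ) * fourierCoeff f k = a k := by
      intro k
      rw [hf, mul_inv_cancel_left₀]
      exact_mod_cast (weight_pos L 1 k).ne'
    have hm : f ∈ sobolevSubmodule L 1 := by
      rw [mem_sobolevSubmodule_iff]
      simp_rw [hw]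
      exact a.2
    refine ⟨Sobolev.mk f hm, ?_⟩
    ext k
    exact hw k
  have hiso : Isometry (Sobolev.toSeq : Sobolev L 1 → lp (fun _ : ℤ => ℂ) 2) :=
    AddMonoidHomClass.isometry_of_norm _ fun f => (Sobolev.norm_eq_norm_toSeq f).symm
  exact (IsometryEquiv.mk (Equiv.ofBijective _ ⟨hiso.injective, hs⟩) hiso).completeSpace

/-! ### Products in `H¹(𝕋)` -/

lemma summable_fourierCoeff {f : L2T L} (hf : f ∈ sobolevSubmodule L 1) :
    Summable fun k : ℤ => fourierCoeff f k := by
  have hL : (0 : ℝ) < L := Fact.out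
  have h1 := memℓp_two_iff.mp ((mem_sobolevSubmodule_iff 1 f).mp hf)
  have h2 : Summable fun k : ℤ => (weight L 1 k ^ 2)⁻¹ := by
    have h3 : Summable fun k : ℤ => (L / (2 * Real.pi)) ^ 2 * (1 / (k : ℝ) ^ 2) :=
      (Real.summable_one_div_int_pow.mpr one_lt_two).mul_left _
    refine Summable.of_norm_bounded_eventually h3 ?_
    have : ∀ᶠ k : ℤ in cofinite, k ≠ 0 := by
      simpa using (Set.finite_singleton (0 : ℤ)).compl_mem_cofinite
    filter_upwards [this] with k hk
    have hk' : (k : ℝ) ≠ 0 := by exact_mod_cast hk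
    rw [weight_one_sq, Real.norm_of_nonneg (by positivity)]
    have : (L / (2 * Real.pi)) ^ 2 * (1 / (k : ℝ) ^ 2) = (freq L k ^ 2)⁻¹ := by
      unfold freq
      field_simp
    rw [this]
    have hf0 : freq L k ≠ 0 := by
      unfold freq
      have := Real.pi_pos
      positivity
    exact inv_anti₀ (by positivity) (by linarith)
  refine Summable.of_norm_bounded (h1.add h2) fun k => ?_
  have hw := weight_pos L 1 k
  rw [norm_mul, Complex.norm_real, Real.norm_of_nonneg hw.le]
  have h4 : ‖fourierCoeff f k‖ = (weight L 1 k * ‖fourierCoeff f k‖) * (weight L 1 k)⁻¹ := by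
    field_simp
  rw [← inv_pow]
  set A := weight L 1 k * ‖fourierCoeff f k‖
  rw [h4]
  nlinarith [sq_nonneg (A - (weight L 1 k)⁻¹), sq_nonneg A, sq_nonneg (weight L 1 k)⁻¹]

/-- The continuous representative of an element of `H¹(𝕋)`. -/
lemma exists_continuous_rep {f : L2T L} (hf : f ∈ sobolevSubmodule L 1) :
    ∃ F : C(AddCircle L, ℂ), f =ᵐ[AddCircle.haarAddCircle] F ∧
      HasSum (fun k : ℤ => fourierCoeff f k • (fourier k : C(AddCircle L, ℂ))) F := by
  have hs : Summable fun k : ℤ => fourierCoeff f k • (fourier k : C(AddCircle L, ℂ)) := by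
    refine Summable.of_norm ?_
    simp only [norm_smul, fourier_norm, mul_one]
    exact (summable_fourierCoeff hf).norm
  refine ⟨_, ?_, hs.hasSum⟩
  set F := ∑' k : ℤ, fourierCoeff f k • (fourier k : C(AddCircle L, ℂ)) with hF
  have h1 : HasSum (fun k : ℤ => fourierCoeff f k • fourierLp 2 k)
      (ContinuousMap.toLp (E := ℂ) 2 AddCircle.haarAddCircle ℂ F) := by
    have := hs.hasSum.mapL (ContinuousMap.toLp (E := ℂ) 2 (AddCircle.haarAddCircle (T := L)) ℂ)
    simpa [map_smul] using this
  have h2 : f = ContinuousMap.toLp (E := ℂ) 2 AddCircle.haarAddCircle ℂ F :=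
    (hasSum_fourier_series_L2 f).unique h1
  have h3 := ContinuousMap.coeFn_toLp (E := ℂ) (p := 2) (𝕜 := ℂ)
    (AddCircle.haarAddCircle (T := L)) F
  rwa [← h2] at h3

lemma memLp_mul (A : L2T L) {f : L2T L} (hf : f ∈ sobolevSubmodule L 1) :
    MemLp (fun x => A x * f x) 2 (AddCircle.haarAddCircle (T := L)) := by
  obtain ⟨F, hF, -⟩ := exists_continuous_rep hf
  have h : MemLp (fun x => F x * A x) 2 (AddCircle.haarAddCircle (T := L)) :=
    (Lp.memLp A).of_le_mul (c := ‖F‖)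
      (F.continuous.aestronglyMeasurable.mul (Lp.aestronglyMeasurable A))
      (ae_of_all _ fun x => by
        rw [norm_mul]
        exact mul_le_mul_of_nonneg_right (F.norm_coe_le_norm x) (norm_nonneg _))
  refine h.ae_eq ?_
  filter_upwards [hF] with x hx
  rw [hx, mul_comm]

lemma hasSum_fourierCoeff_mul (A : L2T L) {f : L2T L} (hf : f ∈ sobolevSubmodule L 1) (n : ℤ) :
    HasSum (fun k : ℤ => fourierCoeff A (n - k) * fourierCoeff f k)
      (fourierCoeff (fun x => A x * f x) n) := by
  obtain ⟨F, hF, hsum⟩ := exists_continuous_rep hf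
  have hA : Integrable A (AddCircle.haarAddCircle (T := L)) :=
    (Lp.memLp A).integrable (by norm_num)
  have hint : ∀ B : C(AddCircle L, ℂ),
      Integrable (fun x => fourier (-n) x * (A x * B x)) (AddCircle.haarAddCircle (T := L)) := by
    intro B
    have h1 := hA.bdd_mul (c := ‖(fourier (-n) : C(AddCircle L, ℂ)) * B‖)
      ((fourier (-n) : C(AddCircle L, ℂ)) * B).continuous.aestronglyMeasurable
      (ae_of_all _ fun x => ContinuousMap.norm_coe_le_norm _ x)
    refine h1.congr (ae_of_all _ fun x => ?_)
    simp only [ContinuousMap.mul_apply]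
    ring
  let Λ : C(AddCircle L, ℂ) →ₗ[ℂ] ℂ :=
    { toFun := fun B => ∫ x, fourier (-n) x * (A x * B x) ∂AddCircle.haarAddCircle
      map_add' := fun B B' => by
        rw [← integral_add (hint B) (hint B')]
        refine integral_congr_ae (ae_of_all _ fun x => ?_)
        simp only [ContinuousMap.add_apply]
        ring
      map_smul' := fun c B => by
        rw [RingHom.id_apply, smul_eq_mul, ← integral_const_mul]
        refine integral_congr_ae (ae_of_all _ fun x => ?_)
        simp only [ContinuousMap.smul_apply, smul_eq_mul]
        ring }
  have hbound : ∀ B, ‖Λ B‖ ≤ (∫ x, ‖A x‖ ∂(AddCircle.haarAddCircle (T := L))) * ‖B‖ := by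
    intro B
    rw [← integral_mul_const]
    refine norm_integral_le_of_norm_le (hA.norm.mul_const _) (ae_of_all _ fun x => ?_)
    rw [norm_mul, norm_mul]
    have h1 : ‖fourier (-n) x‖ = 1 := by
      rw [fourier_apply]
      exact Circle.norm_coe _
    rw [h1, one_mul]
    exact mul_le_mul_of_nonneg_left (B.norm_coe_le_norm x) (norm_nonneg _)
  have hΛ := hsum.mapL (Λ.mkContinuous _ hbound)
  have hval : (Λ.mkContinuous _ hbound) F = fourierCoeff (fun x => A x * f x) n := by
    change ∫ x, fourier (-n) x * (A x * F x) ∂AddCircle.haarAddCircle = _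
    unfold fourierCoeff
    refine integral_congr_ae ?_
    filter_upwards [hF] with x hx
    rw [hx, smul_eq_mul]
  rw [hval] at hΛ
  refine hΛ.congr_fun fun k => ?_
  rw [map_smul, smul_eq_mul, mul_comm]
  congr 1
  change fourierCoeff A (n - k) = ∫ x, fourier (-n) x * (A x * fourier k x) ∂AddCircle.haarAddCircle
  unfold fourierCoeff
  refine integral_congr_ae (ae_of_all _ fun x => ?_)
  simp only [smul_eq_mul]
  rw [show -(n - k) = -n + k by ring, fourier_add]
  ring

/-- `H¹(𝕋)` is closed under pointwise products. -/
lemma mul_mem {f g : L2T L} (hf : f ∈ sobolevSubmodule L 1) (hg : g ∈ sobolevSubmodule L 1) :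
    (memLp_mul f hg).toLp (fun x => f x * g x) ∈ sobolevSubmodule L 1 := by
  obtain ⟨f', hf'⟩ := (mem_one_iff f).mp hf
  obtain ⟨g', hg'⟩ := (mem_one_iff g).mp hg
  rw [mem_one_iff]
  refine ⟨(memLp_mul f' hg).toLp _ + (memLp_mul g' hf).toLp _, fun n => ?_⟩
  rw [fourierCoeff_add', fourierCoeff_congr_ae (memLp_mul f' hg).coeFn_toLp,
    fourierCoeff_congr_ae (memLp_mul g' hf).coeFn_toLp,
    fourierCoeff_congr_ae (memLp_mul f hg).coeFn_toLp]
  have h1 := hasSum_fourierCoeff_mul f' hg n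
  have h2 := (Equiv.subLeft n).hasSum_iff.mpr (hasSum_fourierCoeff_mul g' hf n)
  have h3 := (hasSum_fourierCoeff_mul f hg n).mul_left (Complex.I * (freq L n : ℂ))
  refine (h1.add h2).unique (h3.congr_fun fun k => ?_)
  simp only [Function.comp_apply, Equiv.subLeft_apply, hf', hg', sub_sub_cancel]
  have : freq L n = freq L (n - k) + freq L k := by
    unfold freq
    push_cast
    ring
  rw [this]
  push_cast
  ring

/-- `H¹(𝕋)` is closed under complex conjugation. -/
lemma star_mem {f : L2T L} (hf : f ∈ sobolevSubmodule L 1) : star f ∈ sobolevSubmodule L 1 := by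
  have hc : ∀ (h : L2T L) (k : ℤ),
      fourierCoeff (star h : L2T L) k = (starRingEnd ℂ) (fourierCoeff h (-k)) := by
    intro h k
    unfold fourierCoeff
    rw [← integral_conj]
    refine integral_congr_ae ?_
    filter_upwards [Lp.coeFn_star h] with x hx
    simp only [hx, Pi.star_apply, smul_eq_mul, map_mul, neg_neg]
    rw [fourier_neg]
    rfl
  obtain ⟨f', hf'⟩ := (mem_one_iff f).mp hf
  refine (mem_one_iff _).mpr ⟨star f', fun k => ?_⟩
  rw [hc, hc, hf']
  simp only [map_mul, Complex.conj_I, Complex.conj_ofReal]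
  have : freq L (-k) = -freq L k := by
    unfold freq
    push_cast
    ring
  rw [this]
  push_cast
  ring

end

namespace Sobolev

variable {L : ℝ} [Fact (0 < L)]

/-- The pointwise product of two elements of `H¹(𝕋)`. -/
def mul (f g : Sobolev L 1) : Sobolev L 1 :=
  mk ((memLp_mul f.toL2 g.toL2_mem).toLp (fun x => f x * g x)) (mul_mem f.toL2_mem g.toL2_mem)

lemma coeFn_mul (f g : Sobolev L 1) :
    mul f g =ᵐ[AddCircle.haarAddCircle] fun x => f x * g x :=
  (memLp_mul f.toL2 g.toL2_mem).coeFn_toLp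

/-- The position density `|f|²` of `f ∈ H¹(𝕋)`, again an element of `H¹(𝕋)`. -/
def density (f : Sobolev L 1) : Sobolev L 1 := mul f (mk (star f.toL2) (star_mem f.toL2_mem))

lemma coeFn_density (f : Sobolev L 1) :
    density f =ᵐ[AddCircle.haarAddCircle] fun x => ((‖f x‖ ^ 2 : ℝ) : ℂ) := by
  refine (coeFn_mul _ _).trans ?_
  filter_upwards [Lp.coeFn_star f.toL2] with x hx
  rw [toL2_mk, hx]
  simp only [Pi.star_apply, RCLike.star_def, Complex.mul_conj, Complex.normSq_eq_norm_sq]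

lemma norm_phase (L t : ℝ) (k : ℤ) :
    ‖Complex.exp (-(Complex.I * t * freq L k ^ 2 / 2))‖ = 1 := by
  rw [show (-(Complex.I * t * freq L k ^ 2 / 2) : ℂ) =
    ((-(t * freq L k ^ 2 / 2) : ℝ) : ℂ) * Complex.I by push_cast; ring]
  exact Complex.norm_exp_ofReal_mul_I _

lemma free_memℓp (t : ℝ) (f : L2T L) :
    Memℓp (fun k : ℤ =>
      Complex.exp (-(Complex.I * t * freq L k ^ 2 / 2)) * fourierCoeff f k) 2 := by
  refine memℓp_two_of_le (b := fun k : ℤ => fourierCoeff f k) (memℓp_fourierCoeff f) fun k => ?_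
  rw [norm_mul]
  rw [norm_phase, one_mul]

/-- The free Schrödinger group `e^{i t ∂ₓ² / 2}` on `L²(𝕋)`: the Fourier multiplier
`e^{-i t (2πk/L)² / 2}`. -/
def freeL2 (t : ℝ) (f : L2T L) : L2T L := fourierBasis.repr.symm ⟨_, free_memℓp t f⟩

lemma fourierCoeff_freeL2 (t : ℝ) (f : L2T L) (k : ℤ) :
    fourierCoeff (freeL2 t f) k =
      Complex.exp (-(Complex.I * t * freq L k ^ 2 / 2)) * fourierCoeff f k := by
  rw [← fourierBasis_repr, freeL2, LinearIsometryEquiv.apply_symm_apply]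

lemma freeL2_mem (t : ℝ) {s : ℝ} (f : Sobolev L s) : freeL2 t f.toL2 ∈ sobolevSubmodule L s := by
  rw [mem_sobolevSubmodule_iff]
  refine memℓp_two_of_le (b := fun k : ℤ => (weight L s k : ℂ) * fourierCoeff f k) f.toL2_mem
    fun k => ?_
  rw [fourierCoeff_freeL2, norm_mul, norm_mul, norm_mul]
  rw [norm_phase, one_mul]

/-- The free Schrödinger group `e^{i t ∂ₓ² / 2}` on `H^s(𝕋)`. -/
def free (t : ℝ) {s : ℝ} (f : Sobolev L s) : Sobolev L s := mk (freeL2 t f.toL2) (freeL2_mem t f)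

end Sobolev

/-! ### The space `W^{1,∞}(𝕋)` -/

/-- `g` is the weak derivative of `f` on `ℝ / Lℤ`: integration by parts holds against every smooth
`L`-periodic test function. -/
def IsWeakDeriv {L : ℝ} (f g : AddCircle L → ℂ) : Prop :=
  ∀ φ : ℝ → ℂ, ContDiff ℝ (⊤ : ℕ∞) φ → Function.Periodic φ L →
    ∫ x in (0 : ℝ)..L, f x * deriv φ x = -∫ x in (0 : ℝ)..L, g x * φ x

/-- The norm of `W^{1,∞}(𝕋)` with values in `[0, ∞]`: `‖f‖_∞ + ‖g‖_∞` where `g ∈ L^∞` is the weak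
derivative of `f` (unique up to null sets), and `∞` if there is none. -/
def w1infENorm {L : ℝ} [Fact (0 < L)] (f : AddCircle L → ℂ) : ℝ≥0∞ :=
  ⨅ (g : AddCircle L → ℂ) (_ : MemLp g ∞ (AddCircle.haarAddCircle (T := L)) ∧ IsWeakDeriv f g),
    eLpNorm f ∞ AddCircle.haarAddCircle + eLpNorm g ∞ AddCircle.haarAddCircle

/-- `f ∈ W^{1,∞}(𝕋)`. -/
def MemW1inf {L : ℝ} [Fact (0 < L)] (f : AddCircle L → ℂ) : Prop :=
  AEStronglyMeasurable f (AddCircle.haarAddCircle (T := L)) ∧ w1infENorm f < ∞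

/-- The norm of `W^{1,∞}(𝕋)` as a real number. -/
def w1infNorm {L : ℝ} [Fact (0 < L)] (f : AddCircle L → ℂ) : ℝ := (w1infENorm f).toReal

/-! ### The random potential -/

/-- The product Gaussian measure `⨂ⱼ N(0, 1)` on `ℝ^ℕ`. -/
def gaussianSeq : Measure (ℕ → ℝ) := Measure.infinitePi fun _ => gaussianReal 0 1

/-- The Gaussian random potential `V(ξ) = v₀ + ∑ⱼ λⱼ ξⱼ vⱼ`, the series converging in `H¹(𝕋)`. -/
def potential {L : ℝ} [Fact (0 < L)] (v₀ : Sobolev L 1) (lam : ℕ → ℝ) (v : ℕ → Sobolev L 1)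
    (ξ : ℕ → ℝ) : Sobolev L 1 :=
  v₀ + ∑' j, ((lam j * ξ j : ℝ) : ℂ) • v j

/-- The truncated potential `V_m(ξ) = v₀ + ∑_{j < m} λⱼ ξⱼ vⱼ`; indices start at `0`. -/
def truncPotential {L : ℝ} [Fact (0 < L)] (v₀ : Sobolev L 1) (lam : ℕ → ℝ) (v : ℕ → Sobolev L 1)
    (m : ℕ) (ξ : ℕ → ℝ) : Sobolev L 1 :=
  v₀ + ∑ j ∈ Finset.range m, ((lam j * ξ j : ℝ) : ℂ) • v j

/-! ### Solutions and mixed norms -/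

/-- `ψ ∈ C([0,∞), H¹(𝕋))` solves `i ∂ₜψ = -½ ∂ₓ²ψ + V ψ`, `ψ(0) = ψin`, in the sense of Duhamel's
formula `ψ(t) = e^{it∂ₓ²/2} ψin - i ∫₀ᵗ e^{i(t-ρ)∂ₓ²/2} (V ψ(ρ)) dρ`. -/
def IsMildSolution {L : ℝ} [Fact (0 < L)] (V ψin : Sobolev L 1) (ψ : ℝ → Sobolev L 1) : Prop :=
  ContinuousOn ψ (Set.Ici 0) ∧
    ∀ t, 0 ≤ t → ψ t = Sobolev.free t ψin -
      Complex.I • ∫ ρ in (0 : ℝ)..t, Sobolev.free (t - ρ) (Sobolev.mul V (ψ ρ))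

/-- There is one and only one mild solution on `[0, ∞)`. -/
def WellPosed {L : ℝ} [Fact (0 < L)] (V ψin : Sobolev L 1) : Prop :=
  ∃ ψ : ℝ → Sobolev L 1, IsMildSolution V ψin ψ ∧
    ∀ ψ', IsMildSolution V ψin ψ' → Set.EqOn ψ' ψ (Set.Ici 0)

/-- The norm of `L^∞((0,T), E)`, with values in `[0, ∞]`. -/
def linftyENorm {E : Type*} [NormedAddCommGroup E] (T : ℝ) (u : ℝ → E) : ℝ≥0∞ :=
  eLpNorm u ∞ (volume.restrict (Set.Ioo 0 T))

/-- The norm of `L^q_μ(U, L^∞((0,T), E))`, with values in `[0, ∞]`. -/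
def lqLinftyENorm {E : Type*} [NormedAddCommGroup E] (q T : ℝ) (u : ℝ → (ℕ → ℝ) → E) : ℝ≥0∞ :=
  (∫⁻ ξ, linftyENorm T (fun t => u t ξ) ^ q ∂gaussianSeq) ^ (1 / q)

/-- Membership in `L^q_μ(U, L^∞((0,T), E))`. -/
def MemLqLinfty {E : Type*} [NormedAddCommGroup E] (q T : ℝ) (u : ℝ → (ℕ → ℝ) → E) : Prop :=
  (∀ᵐ ξ ∂gaussianSeq, MemLp (fun t => u t ξ) ∞ (volume.restrict (Set.Ioo 0 T))) ∧
    AEMeasurable (fun ξ => linftyENorm T (fun t => u t ξ)) gaussianSeq ∧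
    lqLinftyENorm q T u < ∞

end RandomSchrodinger

end

open RandomSchrodinger

/-!
In one dimension `H¹(𝕋)` is a Banach algebra: by the Sobolev embedding into `C(𝕋)`
(`Sobolev.exists_continuous_rep_norm_le`) and the product rule (`Sobolev.isFourierDeriv_mul`),
`‖f g‖ ≤ κ ‖f‖ ‖g‖` in `H¹`. Multiplication by a potential `V ∈ H¹(𝕋)` is therefore a bounded
perturbation of the free Schrödinger group, which acts on `H¹(𝕋)` by isometries. In the interaction
picture `φ(t) = e^{-it∂ₓ²/2} ψ(t)` Duhamel's formula is a linear ordinary differential equation with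
a bounded, strongly continuous coefficient. The Dyson series solves it
(`exists_isDuhamelSolution`), and Grönwall's inequality gives the bounds

* `‖ψ(t)‖ ≤ ‖ψin‖ exp(κ ‖V‖ t)` (`IsMildSolution.norm_le`),
* `‖ψ₁(t) - ψ₂(t)‖ ≤ t κ ‖ψin‖ ‖V₁ - V₂‖ exp(κ (‖V₁‖ + ‖V₂‖) t)` (`IsMildSolution.norm_sub_le`),

the second of which contains uniqueness.

The random potential and all its truncations are bounded in `H¹(𝕋)` by `‖v₀‖ + S`, where
`S(ξ) = ∑ⱼ λⱼ ‖vⱼ‖ |ξⱼ|`. Since `∑ⱼ λⱼ ‖vⱼ‖ < ∞`, Jensen's inequality bounds `exp(c S)` by a constant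
plus a convergent combination of the `exp(c' |ξⱼ|)`, so `S` has all exponential moments
(`integrable_exp_absSum`). Hölder's inequality with exponents `2 + ε` and `2 (2 + ε) / ε` then
transfers the rate of `V_m - V` in `L^{2+ε}` to `ψ_m - ψ` in `L²(U, L^∞((0,T), H¹(𝕋)))`
(`exists_lqLinfty_sub_le`). As `|ψ|²` is a bounded sesquilinear expression in the algebra `H¹(𝕋)`,
the same argument with a larger exponential weight gives the rate for `E[G(|ψ|²)]`
(`exists_norm_integral_density_sub_le`).

The solution map `V ↦ ψ(t)` is continuous, which makes `ψ(t, ·)` measurable, and the norm of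
`L^∞((0,T), H¹(𝕋))` of a continuous function is a supremum over rational times
(`linftyENorm_eq_iSup`), which makes it measurable in `ξ`.
-/

noncomputable section

namespace RandomSchrodinger

/-! ### Duhamel's formula in a Banach space -/

section Duhamel

lemma gronwallBound_zero_le {K ε t : ℝ} (hK : 0 ≤ K) (hε : 0 ≤ ε) :
    gronwallBound 0 K ε t ≤ ε * t * Real.exp (K * t) := by
  rcases hK.eq_or_lt with rfl | hK
  · simp [gronwallBound_K0]
  · simp only [gronwallBound_of_K_ne_0 hK.ne', zero_mul, zero_add]
    -- `e^y - 1 ≤ y e^y` is `1 - y ≤ e^{-y}`.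
    have h1 : Real.exp (K * t) - 1 ≤ K * t * Real.exp (K * t) := by
      have h2 := Real.add_one_le_exp (-(K * t))
      have h3 : Real.exp (-(K * t)) * Real.exp (K * t) = 1 := by
        rw [← Real.exp_add, neg_add_cancel, Real.exp_zero]
      nlinarith [Real.exp_pos (K * t)]
    calc ε / K * (Real.exp (K * t) - 1) ≤ ε / K * (K * t * Real.exp (K * t)) := by gcongr
      _ = ε * t * Real.exp (K * t) := by field_simp

variable {E : Type*} [NormedAddCommGroup E] [NormedSpace ℂ E]

/-- A strongly continuous one-parameter group of linear isometries. -/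
structure IsIsometricGroup (U : ℝ → E →ₗᵢ[ℂ] E) : Prop where
  zero : ∀ x, U 0 x = x
  add : ∀ s t x, U (s + t) x = U s (U t x)
  continuous : ∀ x, Continuous fun t => U t x

/-- `ψ ∈ C([0,∞), E)` satisfies `ψ(t) = U(t) x₀ - i ∫₀ᵗ U(t-ρ) B ψ(ρ) dρ`. -/
def IsDuhamelSolution (U : ℝ → E →ₗᵢ[ℂ] E) (B : E →L[ℂ] E) (x₀ : E) (ψ : ℝ → E) : Prop :=
  ContinuousOn ψ (Set.Ici 0) ∧
    ∀ t, 0 ≤ t → ψ t = U t x₀ - Complex.I • ∫ ρ in (0 : ℝ)..t, U (t - ρ) (B (ψ ρ))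

variable {U : ℝ → E →ₗᵢ[ℂ] E} {B B₁ B₂ : E →L[ℂ] E} {x₀ : E} {ψ ψ₁ ψ₂ : ℝ → E}

lemma IsIsometricGroup.continuous_uncurry (hU : IsIsometricGroup U) :
    Continuous fun p : ℝ × E => U p.1 p.2 :=
  continuous_prod_of_continuous_lipschitzWith' _ 1 (fun t => (U t).lipschitz) hU.continuous

lemma IsIsometricGroup.neg_apply (hU : IsIsometricGroup U) (t : ℝ) (x : E) :
    U (-t) (U t x) = x := by
  rw [← hU.add, neg_add_cancel, hU.zero]

lemma IsIsometricGroup.continuousOn_apply (hU : IsIsometricGroup U) {s : Set ℝ} {τ : ℝ → ℝ}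
    {f : ℝ → E} (hτ : ContinuousOn τ s) (hf : ContinuousOn f s) :
    ContinuousOn (fun t => U (τ t) (f t)) s :=
  hU.continuous_uncurry.comp_continuousOn (hτ.prodMk hf)

lemma IsDuhamelSolution.continuousOn_interaction (hU : IsIsometricGroup U)
    (h : IsDuhamelSolution U B x₀ ψ) (T : ℝ) :
    ContinuousOn (fun t => U (-t) (ψ t)) (Set.Icc 0 T) :=
  hU.continuousOn_apply (by fun_prop) (h.1.mono Set.Icc_subset_Ici_self)

lemma IsDuhamelSolution.apply_zero (hU : IsIsometricGroup U) (h : IsDuhamelSolution U B x₀ ψ) :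
    ψ 0 = x₀ := by
  simpa [hU.zero] using h.2 0 le_rfl

/-- The terms of the Dyson series in the interaction picture: iterated time integrals. -/
def dyson (U : ℝ → E →ₗᵢ[ℂ] E) (B : E →L[ℂ] E) (x₀ : E) : ℕ → ℝ → E
  | 0, _ => x₀
  | n + 1, t => ∫ ρ in (0 : ℝ)..t, -(Complex.I • U (-ρ) (B (U ρ (dyson U B x₀ n ρ))))

lemma IsIsometricGroup.continuousOn_interactionField (hU : IsIsometricGroup U) {f : ℝ → E}
    {s : Set ℝ} (hf : ContinuousOn f s) :
    ContinuousOn (fun ρ => -(Complex.I • U (-ρ) (B (U ρ (f ρ))))) s :=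
  ((hU.continuousOn_apply continuousOn_neg (B.continuous.comp_continuousOn
    (hU.continuousOn_apply continuousOn_id hf))).const_smul _).neg

/-- The generator in the interaction picture is bounded by `‖B‖`, uniformly in time. -/
lemma norm_interactionField_le (ρ : ℝ) (x : E) :
    ‖-(Complex.I • U (-ρ) (B (U ρ x)))‖ ≤ ‖B‖ * ‖x‖ := by
  simp only [norm_neg, norm_smul, Complex.norm_I, one_mul, LinearIsometry.norm_map]
  exact (B.le_opNorm _).trans_eq (by rw [LinearIsometry.norm_map])

lemma continuous_dyson (hU : IsIsometricGroup U) (n : ℕ) : Continuous (dyson U B x₀ n) := by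
  induction n with
  | zero => exact continuous_const
  | succ n ih =>
    have := continuousOn_univ.mp (hU.continuousOn_interactionField (B := B) ih.continuousOn)
    exact intervalIntegral.continuous_primitive (fun a b => this.intervalIntegrable a b) 0

lemma norm_dyson_le (n : ℕ) {t : ℝ} (ht : 0 ≤ t) :
    ‖dyson U B x₀ n t‖ ≤ ‖x₀‖ * ((‖B‖ * t) ^ n / n.factorial) := by
  induction n generalizing t with
  | zero => simp [dyson]
  | succ n ih =>
    rw [dyson]
    have h1 : ‖∫ ρ in (0 : ℝ)..t, -(Complex.I • U (-ρ) (B (U ρ (dyson U B x₀ n ρ))))‖ ≤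
        ∫ ρ in (0 : ℝ)..t, ‖B‖ * (‖x₀‖ * ((‖B‖ * ρ) ^ n / n.factorial)) := by
      refine intervalIntegral.norm_integral_le_of_norm_le ht (ae_of_all _ fun ρ hρ => ?_)
        (Continuous.intervalIntegrable (by fun_prop) _ _)
      exact (norm_interactionField_le _ _).trans
        (mul_le_mul_of_nonneg_left (ih hρ.1.le) (norm_nonneg _))
    refine h1.trans_eq ?_
    have h2 : ∀ ρ : ℝ, ‖B‖ * (‖x₀‖ * ((‖B‖ * ρ) ^ n / n.factorial)) =
        (‖B‖ ^ (n + 1) * ‖x₀‖ / n.factorial) * ρ ^ n := fun ρ => by ring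
    simp only [h2, intervalIntegral.integral_const_mul, integral_pow, Nat.factorial_succ]
    have := n.factorial_ne_zero
    rw [zero_pow n.succ_ne_zero, sub_zero, mul_pow]
    push_cast
    field_simp

variable [CompleteSpace E]

/-- In the interaction picture `φ(t) = U(-t) ψ(t)`, Duhamel's formula becomes
`φ(t) = x₀ - i ∫₀ᵗ U(-ρ) B ψ(ρ) dρ`. -/
lemma IsDuhamelSolution.interaction_eq (hU : IsIsometricGroup U)
    (h : IsDuhamelSolution U B x₀ ψ) {t : ℝ} (ht : 0 ≤ t) :
    U (-t) (ψ t) = x₀ - Complex.I • ∫ ρ in (0 : ℝ)..t, U (-ρ) (B (ψ ρ)) := by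
  have hint : IntervalIntegrable (fun ρ => U (t - ρ) (B (ψ ρ))) volume 0 t := by
    refine ContinuousOn.intervalIntegrable ?_
    rw [Set.uIcc_of_le ht]
    exact hU.continuousOn_apply (by fun_prop)
      (B.continuous.comp_continuousOn (h.1.mono Set.Icc_subset_Ici_self))
  have := (U (-t)).toContinuousLinearMap.intervalIntegral_comp_comm hint
  simp only [LinearIsometry.coe_toContinuousLinearMap] at this
  rw [h.2 t ht, map_sub, hU.neg_apply, map_smul, ← this]
  simp only [← hU.add]
  congr! 6
  ring

lemma IsDuhamelSolution.hasDerivWithinAt (hU : IsIsometricGroup U)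
    (h : IsDuhamelSolution U B x₀ ψ) {t : ℝ} (ht : 0 ≤ t) :
    HasDerivWithinAt (fun t => U (-t) (ψ t)) (-(Complex.I • U (-t) (B (ψ t)))) (Set.Ici t) t := by
  -- The constant extension of `ψ` to negative times makes the integrand continuous on `ℝ`.
  have hψ : Continuous fun ρ => ψ (max ρ 0) :=
    h.1.comp_continuous (by fun_prop) fun ρ => le_max_right ρ 0
  have hg : Continuous fun ρ => U (-ρ) (B (ψ (max ρ 0))) :=
    hU.continuous_uncurry.comp (continuous_neg.prodMk (B.continuous.comp hψ))
  have h1 := ((hg.integral_hasStrictDerivAt 0 t).hasDerivAt.const_smul Complex.I).const_sub x₀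
  have h2 : ∀ r, 0 ≤ r → U (-r) (ψ r) =
      x₀ - Complex.I • ∫ ρ in (0 : ℝ)..r, U (-ρ) (B (ψ (max ρ 0))) := by
    intro r hr
    rw [h.interaction_eq hU hr]
    congr 2
    refine intervalIntegral.integral_congr fun ρ hρ => ?_
    rw [Set.uIcc_of_le hr] at hρ
    simp only [max_eq_left hρ.1]
  simp only [max_eq_left ht] at h1
  exact h1.hasDerivWithinAt.congr (fun r hr => h2 r (ht.trans hr)) (h2 t ht)

lemma IsDuhamelSolution.norm_le (hU : IsIsometricGroup U) (h : IsDuhamelSolution U B x₀ ψ)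
    {t : ℝ} (ht : 0 ≤ t) : ‖ψ t‖ ≤ ‖x₀‖ * Real.exp (‖B‖ * t) := by
  have h1 := norm_le_gronwallBound_of_norm_deriv_right_le (δ := ‖x₀‖) (K := ‖B‖) (ε := 0)
    (h.continuousOn_interaction hU t) (fun r hr => h.hasDerivWithinAt hU hr.1)
    (by simp [h.apply_zero hU]) (fun r _ => by
      simp only [norm_neg, norm_smul, Complex.norm_I, one_mul, LinearIsometry.norm_map, add_zero]
      exact B.le_opNorm _) t ⟨ht, le_rfl⟩
  simpa [gronwallBound_ε0] using h1

/-- Stability of Duhamel's formula with respect to the bounded perturbation. -/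
lemma IsDuhamelSolution.norm_sub_le (hU : IsIsometricGroup U)
    (h₁ : IsDuhamelSolution U B₁ x₀ ψ₁) (h₂ : IsDuhamelSolution U B₂ x₀ ψ₂) {t : ℝ} (ht : 0 ≤ t) :
    ‖ψ₁ t - ψ₂ t‖ ≤ t * ‖x₀‖ * ‖B₁ - B₂‖ * Real.exp ((‖B₁‖ + ‖B₂‖) * t) := by
  have h1 := norm_le_gronwallBound_of_norm_deriv_right_le (δ := 0) (K := ‖B₁‖)
    (ε := ‖B₁ - B₂‖ * (‖x₀‖ * Real.exp (‖B₂‖ * t)))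
    ((h₁.continuousOn_interaction hU t).sub (h₂.continuousOn_interaction hU t))
    (fun r hr => (h₁.hasDerivWithinAt hU hr.1).sub (h₂.hasDerivWithinAt hU hr.1))
    (by simp [h₁.apply_zero hU, h₂.apply_zero hU]) (fun r hr => by
      have e : -(Complex.I • U (-r) (B₁ (ψ₁ r))) - -(Complex.I • U (-r) (B₂ (ψ₂ r))) =
          -(Complex.I • U (-r) (B₁ (ψ₁ r - ψ₂ r) + (B₁ - B₂) (ψ₂ r))) := by
        simp only [map_add, map_sub, _root_.sub_apply, smul_add, smul_sub]
        abel
      rw [e, Pi.sub_apply, ← map_sub]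
      simp only [norm_neg, norm_smul, Complex.norm_I, one_mul, LinearIsometry.norm_map]
      refine (norm_add_le _ _).trans (add_le_add (B₁.le_opNorm _) ?_)
      refine ((B₁ - B₂).le_opNorm _).trans ?_
      gcongr
      refine (h₂.norm_le hU hr.1).trans ?_
      gcongr
      exact hr.2.le) t ⟨ht, le_rfl⟩
  rw [Pi.sub_apply, ← map_sub, LinearIsometry.norm_map, sub_zero] at h1
  refine (h1.trans (gronwallBound_zero_le (norm_nonneg _) (by positivity))).trans_eq ?_
  rw [add_mul, Real.exp_add]
  ring

/-- The sum of the Dyson series solves Duhamel's formula. -/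
lemma exists_isDuhamelSolution (hU : IsIsometricGroup U) (B : E →L[ℂ] E) (x₀ : E) :
    ∃ ψ, IsDuhamelSolution U B x₀ ψ := by
  set φ : ℝ → E := fun t => ∑' n, dyson U B x₀ n t with hφ
  have hsum : ∀ R : ℝ, Summable fun n : ℕ => ‖x₀‖ * ((‖B‖ * R) ^ n / n.factorial) := fun R =>
    (Real.summable_pow_div_factorial _).mul_left _
  have hbd : ∀ R : ℝ, ∀ n, ∀ t ∈ Set.Icc 0 R,
      ‖dyson U B x₀ n t‖ ≤ ‖x₀‖ * ((‖B‖ * R) ^ n / n.factorial) := by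
    intro R n t ht
    refine (norm_dyson_le n ht.1).trans ?_
    have := ht.1
    have := ht.2
    gcongr
  have hcR : ∀ R : ℝ, ContinuousOn φ (Set.Icc 0 R) := fun R =>
    continuousOn_tsum (fun n => (continuous_dyson hU n).continuousOn) (hsum R) (hbd R)
  have hc : ContinuousOn φ (Set.Ici 0) := by
    refine continuousOn_of_locally_continuousOn fun t ht =>
      ⟨Set.Iio (t + 1), isOpen_Iio, by simp, (hcR (t + 1)).mono ?_⟩
    exact fun r hr => ⟨hr.1, le_of_lt hr.2⟩
  have hsm : ∀ t, 0 ≤ t → Summable fun n => dyson U B x₀ n t := fun t ht =>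
    Summable.of_norm_bounded (hsum t) fun n => hbd t n t ⟨ht, le_rfl⟩
  have hint : ∀ t, 0 ≤ t → φ t = x₀ +
      ∫ ρ in (0 : ℝ)..t, -(Complex.I • U (-ρ) (B (U ρ (φ ρ)))) := by
    intro t ht
    have h1 : HasSum (fun n => ∫ ρ in (0 : ℝ)..t,
        -(Complex.I • U (-ρ) (B (U ρ (dyson U B x₀ n ρ)))))
        (∫ ρ in (0 : ℝ)..t, -(Complex.I • U (-ρ) (B (U ρ (φ ρ))))) := by
      refine intervalIntegral.hasSum_integral_of_dominated_convergence
        (fun n _ => ‖B‖ * (‖x₀‖ * ((‖B‖ * t) ^ n / n.factorial))) (fun n => ?_) (fun n => ?_) ?_ ?_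
        ?_
      · exact (continuousOn_univ.mp (hU.continuousOn_interactionField
          (continuous_dyson hU n).continuousOn)).aestronglyMeasurable
      · refine ae_of_all _ fun ρ hρ => (norm_interactionField_le _ _).trans ?_
        rw [Set.uIoc_of_le ht] at hρ
        exact mul_le_mul_of_nonneg_left (hbd t n ρ ⟨hρ.1.le, hρ.2⟩) (norm_nonneg _)
      · exact ae_of_all _ fun _ _ => (hsum t).mul_left _
      · exact intervalIntegrable_const
      · refine ae_of_all _ fun ρ hρ => ?_
        rw [Set.uIoc_of_le ht] at hρ
        let A : E →L[ℂ] E := -(Complex.I • ((U (-ρ)).toContinuousLinearMap.comp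
          (B.comp (U ρ).toContinuousLinearMap)))
        exact (hsm ρ hρ.1.le).hasSum.mapL A
    rw [← h1.tsum_eq, hφ]
    exact (hsm t ht).tsum_eq_zero_add
  refine ⟨fun t => U t (φ t), hU.continuousOn_apply continuousOn_id hc, fun t ht => ?_⟩
  have hii : IntervalIntegrable (fun ρ => -(Complex.I • U (-ρ) (B (U ρ (φ ρ))))) volume 0 t := by
    refine ContinuousOn.intervalIntegrable ?_
    rw [Set.uIcc_of_le ht]
    exact hU.continuousOn_interactionField (hcR t)
  have h2 := (U t).toContinuousLinearMap.intervalIntegral_comp_comm hii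
  simp only [LinearIsometry.coe_toContinuousLinearMap] at h2
  simp only
  rw [hint t ht, map_add, ← h2, sub_eq_add_neg, ← intervalIntegral.integral_smul,
    ← intervalIntegral.integral_neg]
  simp only [map_neg, map_smul, ← hU.add, sub_eq_add_neg]

end Duhamel

/-! ### `H¹(𝕋)` is a Banach algebra -/

section Algebra

variable {L : ℝ} [Fact (0 < L)]

lemma hasSum_sq_fourierCoeff (f : L2T L) :
    HasSum (fun k : ℤ => ‖fourierCoeff f k‖ ^ 2) (‖f‖ ^ 2) := by
  have h := lp.norm_rpow_eq_tsum (p := 2) (by norm_num) (fourierBasis.repr f)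
  norm_num [fourierBasis_repr] at h
  rw [h]
  exact (summable_sq_fourierCoeff f).hasSum

lemma summable_inv_weight_one_sq (L : ℝ) [Fact (0 < L)] :
    Summable fun k : ℤ => (weight L 1 k ^ 2)⁻¹ := by
  have hL : (0 : ℝ) < L := Fact.out
  have h3 : Summable fun k : ℤ => (L / (2 * Real.pi)) ^ 2 * (1 / (k : ℝ) ^ 2) :=
    (Real.summable_one_div_int_pow.mpr one_lt_two).mul_left _
  refine Summable.of_norm_bounded_eventually h3 ?_
  have : ∀ᶠ k : ℤ in cofinite, k ≠ 0 := by
    simpa using (Set.finite_singleton (0 : ℤ)).compl_mem_cofinite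
  filter_upwards [this] with k hk
  have hk' : (k : ℝ) ≠ 0 := by exact_mod_cast hk
  rw [weight_one_sq, Real.norm_of_nonneg (by positivity)]
  have : (L / (2 * Real.pi)) ^ 2 * (1 / (k : ℝ) ^ 2) = (freq L k ^ 2)⁻¹ := by
    unfold freq
    field_simp
  rw [this]
  have hf0 : freq L k ≠ 0 := by
    unfold freq
    have := Real.pi_pos
    positivity
  exact inv_anti₀ (by positivity) (by linarith)

lemma fourierCoeff_sub (f g : L2T L) (k : ℤ) :
    fourierCoeff (f - g : L2T L) k = fourierCoeff f k - fourierCoeff g k := by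
  simp only [← fourierBasis_repr, map_sub, lp.coeFn_sub, Pi.sub_apply]

namespace Sobolev

lemma hasSum_norm_sq {s : ℝ} (f : Sobolev L s) :
    HasSum (fun k : ℤ => (weight L s k * ‖fourierCoeff f k‖) ^ 2) (‖f‖ ^ 2) := by
  have h := lp.norm_rpow_eq_tsum (p := 2) (by norm_num) (toSeq f)
  have h2 := memℓp_two_iff.mp (toSeq f).2
  norm_num at h
  rw [norm_eq_norm_toSeq, h]
  simpa only [toSeq_apply, norm_mul, Complex.norm_real, Real.norm_of_nonneg (weight_pos L s _).le]
    using h2.hasSum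

/-- The Sobolev embedding `H¹(𝕋) ⊆ C(𝕋)`: by Cauchy–Schwarz the Fourier coefficients are absolutely
summable. -/
lemma exists_continuous_rep_norm_le (L : ℝ) [Fact (0 < L)] : ∃ κ : ℝ, 0 ≤ κ ∧
    ∀ f : Sobolev L 1, ∃ F : C(AddCircle L, ℂ),
      f =ᵐ[AddCircle.haarAddCircle] F ∧ ‖F‖ ≤ κ * ‖f‖ := by
  refine ⟨√(∑' k : ℤ, (weight L 1 k ^ 2)⁻¹), Real.sqrt_nonneg _, fun f => ?_⟩
  obtain ⟨F, hF, hsum⟩ := exists_continuous_rep f.toL2_mem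
  refine ⟨F, hF, ?_⟩
  have hn := (summable_fourierCoeff f.toL2_mem).norm
  have h1 : ‖F‖ ≤ ∑' k : ℤ, ‖fourierCoeff f k‖ := by
    rw [← hsum.tsum_eq]
    have e : ∀ k : ℤ, ‖fourierCoeff f k • (fourier k : C(AddCircle L, ℂ))‖ =
        ‖fourierCoeff f k‖ := fun k => by rw [norm_smul, fourier_norm, mul_one]
    refine (norm_tsum_le_tsum_norm ?_).trans_eq (tsum_congr e)
    simpa only [e] using hn
  have h2 := Real.inner_le_Lp_mul_Lq_tsum_of_nonneg (p := 2) (q := 2)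
    Real.HolderConjugate.two_two (f := fun k : ℤ => (weight L 1 k)⁻¹)
    (g := fun k : ℤ => weight L 1 k * ‖fourierCoeff f k‖)
    (fun k => (inv_pos.mpr (weight_pos L 1 k)).le)
    (fun k => mul_nonneg (weight_pos L 1 k).le (norm_nonneg _))
    (by simpa only [Real.rpow_two, inv_pow] using summable_inv_weight_one_sq L)
    (by simpa only [Real.rpow_two] using f.hasSum_norm_sq.summable)
  simp only [Real.rpow_two, f.hasSum_norm_sq.tsum_eq, ← Real.sqrt_eq_rpow,
    Real.sqrt_sq (norm_nonneg f), inv_mul_cancel_left₀ (weight_pos L 1 _).ne', inv_pow] at h2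
  exact h1.trans h2

/-- `f'` is the weak derivative of `f`, in terms of Fourier coefficients. -/
def IsFourierDeriv (f f' : L2T L) : Prop :=
  ∀ k, fourierCoeff f' k = Complex.I * freq L k * fourierCoeff f k

lemma norm_sq_eq_add {f : Sobolev L 1} {f' : L2T L} (h : IsFourierDeriv f.toL2 f') :
    ‖f‖ ^ 2 = ‖f.toL2‖ ^ 2 + ‖f'‖ ^ 2 := by
  refine f.hasSum_norm_sq.unique
    (((hasSum_sq_fourierCoeff f.toL2).add (hasSum_sq_fourierCoeff f')).congr_fun fun k => ?_)
  rw [h k]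
  simp only [norm_mul, mul_pow, Complex.norm_real, Complex.norm_I, Real.norm_eq_abs, sq_abs,
    weight_one_sq]
  ring

lemma norm_toL2_le (f : Sobolev L 1) : ‖f.toL2‖ ≤ ‖f‖ := by
  obtain ⟨f', hf'⟩ := (mem_one_iff f.toL2).mp f.toL2_mem
  exact abs_le_of_sq_le_sq' (by rw [norm_sq_eq_add hf']; nlinarith [sq_nonneg ‖f'‖])
    (norm_nonneg f) |>.2

lemma norm_deriv_le {f : Sobolev L 1} {f' : L2T L} (h : IsFourierDeriv f.toL2 f') :
    ‖f'‖ ≤ ‖f‖ :=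
  abs_le_of_sq_le_sq' (by rw [norm_sq_eq_add h]; nlinarith [sq_nonneg ‖f.toL2‖])
    (norm_nonneg f) |>.2

/-- The product rule. -/
lemma isFourierDeriv_mul {f g : Sobolev L 1} {f' g' : L2T L} (hf : IsFourierDeriv f.toL2 f')
    (hg : IsFourierDeriv g.toL2 g') :
    IsFourierDeriv (mul f g).toL2
      ((memLp_mul f' g.toL2_mem).toLp _ + (memLp_mul g' f.toL2_mem).toLp _) := by
  intro n
  rw [fourierCoeff_add', fourierCoeff_congr_ae (memLp_mul f' g.toL2_mem).coeFn_toLp,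
    fourierCoeff_congr_ae (memLp_mul g' f.toL2_mem).coeFn_toLp,
    fourierCoeff_congr_ae (coeFn_mul f g)]
  have h1 := hasSum_fourierCoeff_mul f' g.toL2_mem n
  have h2 := (Equiv.subLeft n).hasSum_iff.mpr (hasSum_fourierCoeff_mul g' f.toL2_mem n)
  have h3 := (hasSum_fourierCoeff_mul f.toL2 g.toL2_mem n).mul_left (Complex.I * (freq L n : ℂ))
  refine (h1.add h2).unique (h3.congr_fun fun k => ?_)
  simp only [Function.comp_apply, Equiv.subLeft_apply, hf _, hg _, sub_sub_cancel]
  have : freq L n = freq L (n - k) + freq L k := by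
    unfold freq
    push_cast
    ring
  rw [this]
  push_cast
  ring

/-- An `L²` function times a bounded continuous one. -/
lemma norm_toLp_mul_le (A : L2T L) {f : L2T L} (hf : f ∈ sobolevSubmodule L 1)
    {F : C(AddCircle L, ℂ)} (hF : f =ᵐ[AddCircle.haarAddCircle] F) :
    ‖(memLp_mul A hf).toLp (fun x => A x * f x)‖ ≤ ‖F‖ * ‖A‖ := by
  refine Lp.norm_le_mul_norm_of_ae_le_mul ?_
  filter_upwards [(memLp_mul A hf).coeFn_toLp, hF] with x hx hFx
  rw [hx, norm_mul, hFx, mul_comm]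
  exact mul_le_mul_of_nonneg_right (F.norm_coe_le_norm x) (norm_nonneg _)

lemma exists_norm_mul_le (L : ℝ) [Fact (0 < L)] :
    ∃ κ : ℝ, ∀ f g : Sobolev L 1, ‖mul f g‖ ≤ κ * ‖f‖ * ‖g‖ := by
  obtain ⟨κ, hκ, hrep⟩ := exists_continuous_rep_norm_le L
  -- Each of `f g`, `f' g`, `f g'` has `L²` norm at most `κ ‖f‖ ‖g‖`, and `1² + 2² ≤ 3²`.
  refine ⟨3 * κ, fun f g => ?_⟩
  obtain ⟨F, hF, hFn⟩ := hrep f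
  obtain ⟨G, hG, hGn⟩ := hrep g
  obtain ⟨f', hf'⟩ := (mem_one_iff f.toL2).mp f.toL2_mem
  obtain ⟨g', hg'⟩ := (mem_one_iff g.toL2).mp g.toL2_mem
  have hf := norm_nonneg f
  have hg := norm_nonneg g
  have h1 : ‖(mul f g).toL2‖ ≤ κ * ‖f‖ * ‖g‖ := by
    refine (norm_toLp_mul_le f.toL2 g.toL2_mem hG).trans ?_
    calc ‖G‖ * ‖f.toL2‖ ≤ (κ * ‖g‖) * ‖f‖ := by
          gcongr
          exact norm_toL2_le f
      _ = _ := by ring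
  have h2 : ‖(memLp_mul f' g.toL2_mem).toLp _‖ ≤ κ * ‖f‖ * ‖g‖ := by
    refine (norm_toLp_mul_le f' g.toL2_mem hG).trans ?_
    calc ‖G‖ * ‖f'‖ ≤ (κ * ‖g‖) * ‖f‖ := by
          gcongr
          exact norm_deriv_le hf'
      _ = _ := by ring
  have h3 : ‖(memLp_mul g' f.toL2_mem).toLp _‖ ≤ κ * ‖f‖ * ‖g‖ := by
    refine (norm_toLp_mul_le g' f.toL2_mem hF).trans ?_
    gcongr
    exact norm_deriv_le hg'
  have h4 := norm_sq_eq_add (isFourierDeriv_mul hf' hg')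
  have h5 := (norm_add_le _ _).trans (add_le_add h2 h3)
  have h6 : 0 ≤ κ * ‖f‖ * ‖g‖ := by positivity
  refine abs_le_of_sq_le_sq' ?_ (by linarith) |>.2
  rw [h4]
  have h7 := pow_le_pow_left₀ (norm_nonneg _) h1 2
  have h8 := pow_le_pow_left₀ (norm_nonneg _) h5 2
  nlinarith

lemma toL2_ext {s : ℝ} {f g : Sobolev L s} (h : f =ᵐ[AddCircle.haarAddCircle] g) : f = g :=
  toL2_injective (Lp.ext h)

/-- Pointwise multiplication on `H¹(𝕋)` as a bounded bilinear map. -/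
def mulL (L : ℝ) [Fact (0 < L)] : Sobolev L 1 →L[ℂ] Sobolev L 1 →L[ℂ] Sobolev L 1 :=
  LinearMap.mkContinuousOfExistsBound₂
    (LinearMap.mk₂ ℂ mul
      (fun f₁ f₂ g => toL2_ext <| by
        rw [map_add]
        filter_upwards [coeFn_mul (f₁ + f₂) g, coeFn_mul f₁ g, coeFn_mul f₂ g,
          Lp.coeFn_add f₁.toL2 f₂.toL2, Lp.coeFn_add (mul f₁ g).toL2 (mul f₂ g).toL2]
          with x h1 h2 h3 h4 h5
        rw [map_add] at h1
        rw [h1, h5, Pi.add_apply, h2, h3, h4, Pi.add_apply, add_mul])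
      (fun c f g => toL2_ext <| by
        rw [map_smul]
        filter_upwards [coeFn_mul (c • f) g, coeFn_mul f g, Lp.coeFn_smul c f.toL2,
          Lp.coeFn_smul c (mul f g).toL2] with x h1 h2 h3 h4
        rw [map_smul] at h1
        rw [h1, h4, Pi.smul_apply, h2, h3, Pi.smul_apply, smul_mul_assoc])
      (fun f g₁ g₂ => toL2_ext <| by
        rw [map_add]
        filter_upwards [coeFn_mul f (g₁ + g₂), coeFn_mul f g₁, coeFn_mul f g₂,
          Lp.coeFn_add g₁.toL2 g₂.toL2, Lp.coeFn_add (mul f g₁).toL2 (mul f g₂).toL2]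
          with x h1 h2 h3 h4 h5
        rw [map_add] at h1
        rw [h1, h5, Pi.add_apply, h2, h3, h4, Pi.add_apply, mul_add])
      (fun c f g => toL2_ext <| by
        rw [map_smul]
        filter_upwards [coeFn_mul f (c • g), coeFn_mul f g, Lp.coeFn_smul c g.toL2,
          Lp.coeFn_smul c (mul f g).toL2] with x h1 h2 h3 h4
        rw [map_smul] at h1
        rw [h1, h4, Pi.smul_apply, h2, h3, Pi.smul_apply, mul_smul_comm]))
    (exists_norm_mul_le L)

lemma fourierCoeff_star (h : L2T L) (k : ℤ) :
    fourierCoeff (star h : L2T L) k = (starRingEnd ℂ) (fourierCoeff h (-k)) := by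
  unfold fourierCoeff
  rw [← integral_conj]
  refine integral_congr_ae ?_
  filter_upwards [Lp.coeFn_star h] with x hx
  simp only [hx, Pi.star_apply, smul_eq_mul, map_mul, neg_neg]
  rw [fourier_neg]
  rfl

/-- Complex conjugation on `H¹(𝕋)`. -/
def conj (f : Sobolev L 1) : Sobolev L 1 := mk (star f.toL2) (star_mem f.toL2_mem)

lemma conj_sub (f g : Sobolev L 1) : conj (f - g) = conj f - conj g :=
  toL2_injective <| l2_ext fun k => by
    simp only [map_sub, conj, toL2_mk, fourierCoeff_star, fourierCoeff_sub]

lemma norm_conj (f : Sobolev L 1) : ‖conj f‖ = ‖f‖ := by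
  have h : ‖conj f‖ ^ 2 = ‖f‖ ^ 2 := by
    refine (conj f).hasSum_norm_sq.unique
      (((Equiv.neg ℤ).hasSum_iff.mpr f.hasSum_norm_sq).congr_fun fun k => ?_)
    have h1 : weight L 1 (-k) = weight L 1 k := by
      simp [weight, freq, neg_div]
    simp only [Function.comp_apply, Equiv.neg_apply, h1, conj, toL2_mk, fourierCoeff_star,
      RCLike.norm_conj]
  exact (pow_left_inj₀ (norm_nonneg _) (norm_nonneg _) two_ne_zero).mp h

lemma density_eq (f : Sobolev L 1) : density f = mulL L f (conj f) := rfl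

lemma norm_density_le (f : Sobolev L 1) : ‖density f‖ ≤ ‖mulL L‖ * ‖f‖ ^ 2 := by
  rw [density_eq]
  exact ((mulL L).le_opNorm₂ f (conj f)).trans_eq (by rw [norm_conj]; ring)

lemma norm_density_sub_le (f g : Sobolev L 1) :
    ‖density f - density g‖ ≤ ‖mulL L‖ * (‖f‖ + ‖g‖) * ‖f - g‖ := by
  have e : density f - density g = mulL L f (conj (f - g)) + mulL L (f - g) (conj g) := by
    rw [density_eq, density_eq, conj_sub, map_sub, map_sub, _root_.sub_apply]
    abel
  rw [e]
  refine (norm_add_le _ _).trans ((add_le_add ((mulL L).le_opNorm₂ _ _)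
    ((mulL L).le_opNorm₂ _ _)).trans_eq ?_)
  rw [norm_conj, norm_conj]
  ring

lemma continuous_density : Continuous (density : Sobolev L 1 → Sobolev L 1) := by
  have hc : Continuous (conj : Sobolev L 1 → Sobolev L 1) := by
    refine LipschitzWith.continuous (K := 1) (LipschitzWith.of_dist_le_mul fun f g => ?_)
    rw [dist_eq_norm, dist_eq_norm, ← conj_sub, norm_conj, NNReal.coe_one, one_mul]
  exact ((mulL L).continuous.clm_apply hc)

lemma toL2_incl {r s : ℝ} (h : r ≤ s) (f : Sobolev L s) : (f.incl h).toL2 = f.toL2 := by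
  rw [incl, toL2_mk]

lemma norm_incl_le {r s : ℝ} (h : r ≤ s) (f : Sobolev L s) : ‖f.incl h‖ ≤ ‖f‖ := by
  refine abs_le_of_sq_le_sq' ?_ (norm_nonneg f) |>.2
  refine hasSum_le (fun k => ?_) (f.incl h).hasSum_norm_sq f.hasSum_norm_sq
  have h1 := weight_pos L r k
  have h2 := weight_mono L h k
  rw [toL2_incl]
  gcongr

/-! ### The free Schrödinger group on `H¹(𝕋)` -/

lemma fourierCoeff_free {s : ℝ} (t : ℝ) (f : Sobolev L s) (k : ℤ) :
    fourierCoeff (free t f) k =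
      Complex.exp (-(Complex.I * t * freq L k ^ 2 / 2)) * fourierCoeff f k :=
  fourierCoeff_freeL2 t f.toL2 k

lemma fourierCoeff_ext {s : ℝ} {f g : Sobolev L s}
    (h : ∀ k, fourierCoeff f k = fourierCoeff g k) : f = g :=
  toL2_injective (l2_ext h)

/-- The free Schrödinger group on `H^s(𝕋)` as a family of linear isometries. -/
def freeIso (L s : ℝ) [Fact (0 < L)] (t : ℝ) : Sobolev L s →ₗᵢ[ℂ] Sobolev L s where
  toFun := free t
  map_add' f g := fourierCoeff_ext fun k => by
    simp only [map_add, fourierCoeff_add', fourierCoeff_free, mul_add]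
  map_smul' c f := fourierCoeff_ext fun k => by
    simp only [map_smul, fourierCoeff_smul', fourierCoeff_free, RingHom.id_apply]
    ring
  norm_map' f := by
    have h : ‖free t f‖ ^ 2 = ‖f‖ ^ 2 := by
      refine (free t f).hasSum_norm_sq.unique (f.hasSum_norm_sq.congr_fun fun k => ?_)
      rw [fourierCoeff_free, norm_mul, norm_phase, one_mul]
    exact (pow_left_inj₀ (norm_nonneg _) (norm_nonneg _) two_ne_zero).mp h

@[simp] lemma freeIso_apply {s : ℝ} (t : ℝ) (f : Sobolev L s) : freeIso L s t f = free t f := rfl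

/-- Strong continuity, by dominated convergence in the Fourier series. -/
lemma continuous_free {s : ℝ} (f : Sobolev L s) : Continuous fun t => free t f := by
  rw [continuous_iff_continuousAt]
  intro t
  rw [ContinuousAt, tendsto_iff_norm_sub_tendsto_zero]
  have key : ∀ r, ‖free r f - free t f‖ ^ 2 = ∑' k : ℤ,
      (‖Complex.exp (-(Complex.I * r * freq L k ^ 2 / 2)) -
        Complex.exp (-(Complex.I * t * freq L k ^ 2 / 2))‖ *
          (weight L s k * ‖fourierCoeff f k‖)) ^ 2 := by
    intro r
    rw [← (free r f - free t f).hasSum_norm_sq.tsum_eq]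
    refine tsum_congr fun k => ?_
    have : fourierCoeff ((free r f - free t f : Sobolev L s)) k =
        (Complex.exp (-(Complex.I * r * freq L k ^ 2 / 2)) -
        Complex.exp (-(Complex.I * t * freq L k ^ 2 / 2))) * fourierCoeff f k := by
      rw [sub_mul, ← fourierCoeff_free, ← fourierCoeff_free, map_sub, fourierCoeff_sub]
    rw [this, norm_mul]
    ring
  have h1 : Tendsto (fun r => ‖free r f - free t f‖ ^ 2) (𝓝 t) (𝓝 0) := by
    simp only [key]
    rw [show (0 : ℝ) = ∑' _ : ℤ, (0 : ℝ) from tsum_zero.symm]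
    refine tendsto_tsum_of_dominated_convergence
      (bound := fun k => 4 * (weight L s k * ‖fourierCoeff f k‖) ^ 2)
      (f.hasSum_norm_sq.summable.mul_left _) (fun k => ?_) (Eventually.of_forall fun r k => ?_)
    · have : Continuous fun r : ℝ => (‖Complex.exp (-(Complex.I * r * freq L k ^ 2 / 2)) -
        Complex.exp (-(Complex.I * t * freq L k ^ 2 / 2))‖ *
          (weight L s k * ‖fourierCoeff f k‖)) ^ 2 := by fun_prop
      simpa using this.tendsto t
    · rw [Real.norm_of_nonneg (by positivity), mul_pow]
      gcongr
      have := norm_sub_le (Complex.exp (-(Complex.I * r * freq L k ^ 2 / 2)))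
        (Complex.exp (-(Complex.I * t * freq L k ^ 2 / 2)))
      rw [norm_phase, norm_phase] at this
      nlinarith [norm_nonneg (Complex.exp (-(Complex.I * r * freq L k ^ 2 / 2)) -
        Complex.exp (-(Complex.I * t * freq L k ^ 2 / 2)))]
  have h2 := h1.sqrt
  simpa only [Real.sqrt_sq (norm_nonneg _), Real.sqrt_zero] using h2

lemma isIsometricGroup_freeIso (L s : ℝ) [Fact (0 < L)] : IsIsometricGroup (freeIso L s) where
  zero f := fourierCoeff_ext fun k => by simp [fourierCoeff_free]
  add r t f := fourierCoeff_ext fun k => by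
    simp only [freeIso_apply, fourierCoeff_free, ← mul_assoc, ← Complex.exp_add]
    congr 2
    push_cast
    ring
  continuous f := continuous_free f

end Sobolev

/-! ### Mild solutions for a potential in `H¹(𝕋)` -/

lemma isMildSolution_iff {V ψin : Sobolev L 1} {ψ : ℝ → Sobolev L 1} :
    IsMildSolution V ψin ψ ↔
      IsDuhamelSolution (Sobolev.freeIso L 1) (Sobolev.mulL L V) ψin ψ :=
  Iff.rfl

lemma IsMildSolution.norm_le {V ψin : Sobolev L 1} {ψ : ℝ → Sobolev L 1}
    (h : IsMildSolution V ψin ψ) {t : ℝ} (ht : 0 ≤ t) :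
    ‖ψ t‖ ≤ ‖ψin‖ * Real.exp (‖Sobolev.mulL L‖ * ‖V‖ * t) := by
  refine (IsDuhamelSolution.norm_le (Sobolev.isIsometricGroup_freeIso L 1)
    (isMildSolution_iff.mp h) ht).trans ?_
  gcongr
  exact (Sobolev.mulL L).le_opNorm V

lemma IsMildSolution.norm_sub_le {V₁ V₂ ψin : Sobolev L 1} {ψ₁ ψ₂ : ℝ → Sobolev L 1}
    (h₁ : IsMildSolution V₁ ψin ψ₁) (h₂ : IsMildSolution V₂ ψin ψ₂) {t : ℝ} (ht : 0 ≤ t) :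
    ‖ψ₁ t - ψ₂ t‖ ≤ t * ‖ψin‖ * (‖Sobolev.mulL L‖ * ‖V₁ - V₂‖) *
      Real.exp (‖Sobolev.mulL L‖ * (‖V₁‖ + ‖V₂‖) * t) := by
  refine (IsDuhamelSolution.norm_sub_le (Sobolev.isIsometricGroup_freeIso L 1)
    (isMildSolution_iff.mp h₁) (isMildSolution_iff.mp h₂) ht).trans ?_
  rw [mul_add, ← map_sub]
  gcongr <;> exact (Sobolev.mulL L).le_opNorm _

lemma IsMildSolution.eqOn {V ψin : Sobolev L 1} {ψ₁ ψ₂ : ℝ → Sobolev L 1}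
    (h₁ : IsMildSolution V ψin ψ₁) (h₂ : IsMildSolution V ψin ψ₂) :
    Set.EqOn ψ₁ ψ₂ (Set.Ici 0) := by
  intro t ht
  have := h₁.norm_sub_le h₂ ht
  rw [sub_self, norm_zero, mul_zero, mul_zero, zero_mul] at this
  exact sub_eq_zero.mp (norm_le_zero_iff.mp this)

lemma exists_isMildSolution (V ψin : Sobolev L 1) : ∃ ψ, IsMildSolution V ψin ψ :=
  exists_isDuhamelSolution (Sobolev.isIsometricGroup_freeIso L 1) (Sobolev.mulL L V) ψin

lemma wellPosed (V ψin : Sobolev L 1) : WellPosed V ψin := by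
  obtain ⟨ψ, hψ⟩ := exists_isMildSolution V ψin
  exact ⟨ψ, hψ, fun _ h => h.eqOn hψ⟩

/-- The solution map `V ↦ ψ(t)`; at negative times, where mild solutions are not determined, the
value is unspecified. -/
def solution (ψin V : Sobolev L 1) : ℝ → Sobolev L 1 :=
  (exists_isMildSolution V ψin).choose

lemma isMildSolution_solution (ψin V : Sobolev L 1) :
    IsMildSolution V ψin (solution ψin V) :=
  (exists_isMildSolution V ψin).choose_spec

/-- Continuous dependence on the potential, which yields measurability of random solutions. -/
lemma continuous_solution (ψin : Sobolev L 1) {t : ℝ} (ht : 0 ≤ t) :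
    Continuous fun V => solution ψin V t := by
  rw [continuous_iff_continuousAt]
  intro V
  rw [ContinuousAt, tendsto_iff_norm_sub_tendsto_zero]
  have hb : Continuous fun W : Sobolev L 1 => t * ‖ψin‖ * (‖Sobolev.mulL L‖ * ‖W - V‖) *
      Real.exp (‖Sobolev.mulL L‖ * (‖W‖ + ‖V‖) * t) := by fun_prop
  refine squeeze_zero (fun _ => norm_nonneg _) (fun W => (isMildSolution_solution ψin W).norm_sub_le
    (isMildSolution_solution ψin V) ht) ?_
  simpa using hb.tendsto V

end Algebra

/-! ### Exponential moments of weighted sums of Gaussians -/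

section Gaussian

instance : IsProbabilityMeasure gaussianSeq := by
  unfold gaussianSeq
  infer_instance

/-- The weighted sum `∑ⱼ aⱼ |ξⱼ|`, a majorant of the norm of the random part of the potential. -/
def absSum (a : ℕ → ℝ) (ξ : ℕ → ℝ) : ℝ := ∑' j, a j * |ξ j|

lemma measurable_absSum {a : ℕ → ℝ} (ha : ∀ j, 0 ≤ a j) : Measurable (absSum a) := by
  have e : absSum a = fun ξ => (∑' j, ENNReal.ofReal (a j * |ξ j|)).toReal := by
    funext ξ
    rw [ENNReal.tsum_toReal_eq fun _ => ENNReal.ofReal_ne_top]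
    exact tsum_congr fun j => (ENNReal.toReal_ofReal (mul_nonneg (ha j) (abs_nonneg _))).symm
  rw [e]
  exact (Measurable.tsum fun j => by fun_prop).ennreal_toReal

/-- Jensen's inequality for the weights `aⱼ / b`, completed to total mass one at the point `0`. -/
lemma exp_sum_le {a : ℕ → ℝ} (ha : ∀ j, 0 ≤ a j) {b : ℝ} (hb : 1 ≤ b) (x : ℕ → ℝ)
    (t : Finset ℕ) (hab : ∑ j ∈ t, a j ≤ b) :
    Real.exp (∑ j ∈ t, a j * x j) ≤ 1 + ∑ j ∈ t, a j * Real.exp (b * x j) := by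
  have hb0 : 0 < b := by linarith
  have hw : 0 ≤ ∑ j ∈ t, a j / b := Finset.sum_nonneg fun j _ => div_nonneg (ha j) hb0.le
  have hw1 : ∑ j ∈ t, a j / b ≤ 1 := by
    rw [← Finset.sum_div]
    exact (div_le_one hb0).mpr hab
  have h := convexOn_exp.map_sum_le (t := Finset.insertNone t)
    (w := fun o : Option ℕ => o.elim (1 - ∑ j ∈ t, a j / b) fun j => a j / b)
    (p := fun o : Option ℕ => o.elim 0 fun j => b * x j)
    (by
      rintro (_ | j) _
      · exact sub_nonneg.mpr hw1
      · exact div_nonneg (ha j) hb0.le)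
    (by rw [Finset.sum_insertNone]; simp)
    (fun _ _ => Set.mem_univ _)
  simp only [Finset.sum_insertNone, Option.elim, smul_eq_mul, mul_zero, zero_add, Real.exp_zero,
    mul_one] at h
  have e : ∀ j, a j / b * (b * x j) = a j * x j := fun j => by field_simp
  simp only [e] at h
  refine h.trans (add_le_add (by linarith) (Finset.sum_le_sum fun j _ => ?_))
  exact mul_le_mul_of_nonneg_right (div_le_self (ha j) hb) (Real.exp_pos _).le

lemma lintegral_exp_abs_lt_top (c : ℝ) :
    ∫⁻ x, ENNReal.ofReal (Real.exp (c * |x|)) ∂gaussianReal 0 1 < ∞ := by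
  have h : Integrable (fun x : ℝ => Real.exp (c * |x|)) (gaussianReal 0 1) :=
    integrable_exp_mul_abs (X := id) (integrable_exp_mul_gaussianReal c)
      (integrable_exp_mul_gaussianReal (-c))
  exact h.lintegral_lt_top

lemma lintegral_tsum_exp_lt_top {a : ℕ → ℝ} (ha : ∀ j, 0 ≤ a j) (hs : Summable a) (c : ℝ) :
    ∫⁻ ξ, ∑' j, ENNReal.ofReal (a j * Real.exp (c * |ξ j|)) ∂gaussianSeq < ∞ := by
  have hm : ∀ j, Measurable fun ξ : ℕ → ℝ => ENNReal.ofReal (a j * Real.exp (c * |ξ j|)) :=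
    fun j => by fun_prop
  rw [lintegral_tsum fun j => (hm j).aemeasurable]
  have e : ∀ j, ∫⁻ ξ, ENNReal.ofReal (a j * Real.exp (c * |ξ j|)) ∂gaussianSeq =
      ENNReal.ofReal (a j) * ∫⁻ x, ENNReal.ofReal (Real.exp (c * |x|)) ∂gaussianReal 0 1 := by
    intro j
    simp only [ENNReal.ofReal_mul (ha j)]
    rw [lintegral_const_mul _ (by fun_prop)]
    congr 1
    exact (measurePreserving_eval_infinitePi (fun _ : ℕ => gaussianReal 0 1) j).lintegral_comp
      (f := fun x => ENNReal.ofReal (Real.exp (c * |x|))) (by fun_prop)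
  simp only [e, ENNReal.tsum_mul_right]
  refine ENNReal.mul_lt_top ?_ (lintegral_exp_abs_lt_top c)
  rw [← ENNReal.ofReal_tsum_of_nonneg ha hs]
  exact ENNReal.ofReal_lt_top

lemma ae_summable_abs {a : ℕ → ℝ} (ha : ∀ j, 0 ≤ a j) (hs : Summable a) :
    ∀ᵐ ξ ∂gaussianSeq, Summable fun j => a j * |ξ j| := by
  have h := lintegral_tsum_exp_lt_top ha hs 1
  filter_upwards [ae_lt_top (Measurable.tsum fun j => by fun_prop) h.ne] with ξ hξ
  have h1 := ENNReal.summable_toReal hξ.ne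
  refine h1.of_nonneg_of_le (fun j => mul_nonneg (ha j) (abs_nonneg _)) fun j => ?_
  rw [ENNReal.toReal_ofReal (mul_nonneg (ha j) (Real.exp_pos _).le), one_mul]
  refine mul_le_mul_of_nonneg_left ?_ (ha j)
  linarith [Real.add_one_le_exp |ξ j|]

/-- All exponential moments of `∑ⱼ aⱼ |ξⱼ|` are finite when `∑ⱼ aⱼ < ∞`. By Jensen's inequality no
independence is needed. -/
lemma integrable_exp_absSum {a : ℕ → ℝ} (ha : ∀ j, 0 ≤ a j) (hs : Summable a) (c : ℝ) :
    Integrable (fun ξ => Real.exp (c * absSum a ξ)) gaussianSeq := by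
  have hm : Measurable fun ξ => Real.exp (c * absSum a ξ) :=
    ((measurable_absSum ha).const_mul c).exp
  refine ⟨hm.aestronglyMeasurable, ?_⟩
  rw [hasFiniteIntegral_iff_ofReal (ae_of_all _ fun _ => (Real.exp_pos _).le)]
  set b : ℝ := 1 + ∑' j, a j with hb
  have hb1 : 1 ≤ b := by
    have : 0 ≤ ∑' j, a j := tsum_nonneg ha
    linarith
  have hle : ∀ᵐ ξ ∂gaussianSeq, ENNReal.ofReal (Real.exp (c * absSum a ξ)) ≤
      1 + ∑' j, ENNReal.ofReal (a j * Real.exp (b * c * |ξ j|)) := by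
    filter_upwards [ae_summable_abs ha hs] with ξ hξ
    have h1 : Tendsto (fun n => ENNReal.ofReal (Real.exp (c * ∑ j ∈ Finset.range n, a j * |ξ j|)))
        atTop (𝓝 (ENNReal.ofReal (Real.exp (c * absSum a ξ)))) :=
      ((ENNReal.continuous_ofReal.comp (Real.continuous_exp.comp (continuous_const_mul c))).tendsto
        _).comp hξ.hasSum.tendsto_sum_nat
    refine le_of_tendsto' h1 fun n => ?_
    have h2 := exp_sum_le ha hb1 (fun j => c * |ξ j|) (Finset.range n)
      ((hs.sum_le_tsum _ fun j _ => ha j).trans (by linarith))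
    have h3 : c * ∑ j ∈ Finset.range n, a j * |ξ j| =
        ∑ j ∈ Finset.range n, a j * (c * |ξ j|) := by
      rw [Finset.mul_sum]
      exact Finset.sum_congr rfl fun j _ => by ring
    have h4 : ∀ j, 0 ≤ a j * Real.exp (b * c * |ξ j|) := fun j =>
      mul_nonneg (ha j) (Real.exp_pos _).le
    simp only [← mul_assoc b c] at h2
    rw [h3]
    refine (ENNReal.ofReal_le_ofReal h2).trans ?_
    rw [ENNReal.ofReal_add zero_le_one (Finset.sum_nonneg fun j _ => h4 j), ENNReal.ofReal_one,
      ENNReal.ofReal_sum_of_nonneg fun j _ => h4 j]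
    gcongr
    exact ENNReal.sum_le_tsum _
  refine (lintegral_mono_ae hle).trans_lt ?_
  rw [lintegral_add_left measurable_const]
  exact ENNReal.add_lt_top.mpr ⟨by simp, lintegral_tsum_exp_lt_top ha hs _⟩

lemma memLp_exp_absSum {a : ℕ → ℝ} (ha : ∀ j, 0 ≤ a j) (hs : Summable a) (c : ℝ) {r : ℝ}
    (hr : 0 < r) :
    MemLp (fun ξ => Real.exp (c * absSum a ξ)) (ENNReal.ofReal r) gaussianSeq := by
  rw [← integrable_norm_rpow_iff ((measurable_absSum ha).const_mul c).exp.aestronglyMeasurable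
    (by simpa using hr) ENNReal.ofReal_ne_top]
  refine (integrable_exp_absSum ha hs (c * r)).congr (ae_of_all _ fun ξ => ?_)
  simp only [ENNReal.toReal_ofReal hr.le, Real.norm_of_nonneg (Real.exp_pos _).le]
  rw [← Real.exp_mul]
  ring_nf

/-- Hölder's inequality: an exponential of `∑ⱼ aⱼ |ξⱼ|` is absorbed by the integrability in excess
of `2`. -/
lemma exists_eLpNorm_exp_smul_le {E : Type*} [NormedAddCommGroup E] [NormedSpace ℝ E]
    {a : ℕ → ℝ} (ha : ∀ j, 0 ≤ a j) (hs : Summable a) {ε : ℝ} (hε : 0 < ε) (K c : ℝ) :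
    ∃ C : ℝ, 0 < C ∧ ∀ (D : (ℕ → ℝ) → E) (δ : ℝ), AEStronglyMeasurable D gaussianSeq →
      eLpNorm D (ENNReal.ofReal (2 + ε)) gaussianSeq ≤ ENNReal.ofReal δ →
      eLpNorm (fun ξ => (K * Real.exp (c * absSum a ξ)) • D ξ) 2 gaussianSeq ≤
        ENNReal.ofReal (C * δ) := by
  -- The exponent with `1 / r + 1 / (2 + ε) = 1 / 2`.
  set r : ℝ := 2 * (2 + ε) / ε with hr
  have hr0 : 0 < r := by positivity
  have hM : MemLp (fun ξ => K * Real.exp (c * absSum a ξ)) (ENNReal.ofReal r) gaussianSeq :=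
    (memLp_exp_absSum ha hs c hr0).const_mul K
  set M := eLpNorm (fun ξ => K * Real.exp (c * absSum a ξ)) (ENNReal.ofReal r) gaussianSeq
  have : ENNReal.HolderTriple (ENNReal.ofReal r) (ENNReal.ofReal (2 + ε)) 2 := ⟨by
    rw [← ENNReal.ofReal_inv_of_pos hr0, ← ENNReal.ofReal_inv_of_pos (by positivity),
      ← ENNReal.ofReal_add (by positivity) (by positivity), ← ENNReal.ofReal_ofNat,
      ← ENNReal.ofReal_inv_of_pos (by positivity)]
    congr 1
    rw [hr]
    field_simp
    ring⟩
  refine ⟨M.toReal + 1, by positivity, fun D δ hD hδ => ?_⟩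
  refine (eLpNorm_smul_le_mul_eLpNorm (p := ENNReal.ofReal r) (q := ENNReal.ofReal (2 + ε))
    hD hM.1).trans ?_
  rw [ENNReal.ofReal_mul (by positivity)]
  refine mul_le_mul' ?_ hδ
  rw [← ENNReal.ofReal_toReal hM.2.ne]
  exact ENNReal.ofReal_le_ofReal (by simp [M])

end Gaussian

/-! ### The norm of `L^∞((0,T))` on continuous functions -/

section Linfty

variable {E : Type*} [NormedAddCommGroup E] {T : ℝ} {u : ℝ → E}

/-- For a continuous function the essential supremum is a supremum over rational times, so that it
depends measurably on parameters. -/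
lemma linftyENorm_eq_iSup (hu : ContinuousOn u (Set.Ioo 0 T)) :
    linftyENorm T u = ⨆ (q : ℚ) (_ : (q : ℝ) ∈ Set.Ioo 0 T), ‖u q‖ₑ := by
  rw [linftyENorm, eLpNorm_exponent_top]
  have hue : ContinuousOn (fun t => ‖u t‖ₑ) (Set.Ioo 0 T) := hu.enorm
  apply le_antisymm
  · refine eLpNormEssSup_le_of_ae_enorm_bound ?_
    filter_upwards [ae_restrict_mem measurableSet_Ioo] with t ht
    by_contra! h
    -- The strict inequality persists near `t`, in particular at a rational time.
    obtain ⟨O, hO, hOeq⟩ := (continuousOn_iff'.mp hue) _ (isOpen_Ioi (a := ⨆ (q : ℚ)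
      (_ : (q : ℝ) ∈ Set.Ioo 0 T), ‖u q‖ₑ))
    have htO : t ∈ O ∩ Set.Ioo 0 T := hOeq ▸ ⟨h, ht⟩
    obtain ⟨q, hq⟩ := Rat.isDenseEmbedding_coe_real.dense.exists_mem_open
      (hO.inter isOpen_Ioo) ⟨t, htO⟩
    have h1 : (q : ℝ) ∈ (fun t => ‖u t‖ₑ) ⁻¹' _ ∩ Set.Ioo 0 T := hOeq.symm ▸ hq
    exact absurd (le_iSup₂ (f := fun (q : ℚ) (_ : (q : ℝ) ∈ Set.Ioo 0 T) => ‖u q‖ₑ) q hq.2)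
      (not_le.mpr h1.1)
  · refine iSup₂_le fun q hq => ?_
    by_contra! h
    obtain ⟨O, hO, hOeq⟩ := (continuousOn_iff'.mp hue) _ (isOpen_Ioi (a :=
      eLpNormEssSup u (volume.restrict (Set.Ioo 0 T))))
    have hne : (O ∩ Set.Ioo 0 T).Nonempty := ⟨q, hOeq ▸ ⟨h, hq⟩⟩
    have hpos := (hO.inter isOpen_Ioo).measure_pos volume hne
    have hae := enorm_ae_le_eLpNormEssSup u (volume.restrict (Set.Ioo 0 T))
    rw [ae_restrict_iff' measurableSet_Ioo] at hae
    refine hpos.ne' (measure_mono_null (fun t ht => ?_) hae)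
    have h1 : t ∈ (fun t => ‖u t‖ₑ) ⁻¹' _ ∩ Set.Ioo 0 T := hOeq.symm ▸ ht
    exact fun hc => absurd (hc ht.2) (not_le.mpr h1.1)

lemma linftyENorm_le {b : ℝ≥0∞} (h : ∀ t ∈ Set.Ioo 0 T, ‖u t‖ₑ ≤ b) : linftyENorm T u ≤ b := by
  rw [linftyENorm, eLpNorm_exponent_top]
  refine eLpNormEssSup_le_of_ae_enorm_bound ?_
  filter_upwards [ae_restrict_mem measurableSet_Ioo] with t ht using h t ht

/-- The norm of `L²_μ(U, L^∞((0,T), E))` is at most the `L²_μ` norm of a pointwise majorant. -/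
lemma memLqLinfty_two {F : Type*} [NormedAddCommGroup F] {w : ℝ → (ℕ → ℝ) → E} {g : (ℕ → ℝ) → F}
    (hc : ∀ᵐ ξ ∂gaussianSeq, ContinuousOn (fun t => w t ξ) (Set.Ici 0))
    (hm : ∀ t, 0 ≤ t → AEStronglyMeasurable (w t) gaussianSeq)
    (hw : ∀ᵐ ξ ∂gaussianSeq, ∀ t ∈ Set.Icc 0 T, ‖w t ξ‖ ≤ ‖g ξ‖)
    (hg : eLpNorm g 2 gaussianSeq < ∞) :
    MemLqLinfty 2 T w ∧ lqLinftyENorm 2 T w ≤ eLpNorm g 2 gaussianSeq := by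
  have hle : ∀ᵐ ξ ∂gaussianSeq, linftyENorm T (fun t => w t ξ) ≤ ‖g ξ‖ₑ := by
    filter_upwards [hw] with ξ hξ
    exact linftyENorm_le fun t ht => enorm_le_iff_norm_le.mpr (hξ t ⟨ht.1.le, ht.2.le⟩)
  have hIoo : Set.Ioo 0 T ⊆ Set.Ici 0 := fun t ht => ht.1.le
  have h2 : lqLinftyENorm 2 T w ≤ eLpNorm g 2 gaussianSeq := by
    rw [lqLinftyENorm, eLpNorm_eq_lintegral_rpow_enorm_toReal (by norm_num) (by norm_num),
      ENNReal.toReal_ofNat]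
    refine ENNReal.rpow_le_rpow (lintegral_mono_ae ?_) (by norm_num)
    filter_upwards [hle] with ξ hξ
    exact ENNReal.rpow_le_rpow hξ (by norm_num)
  refine ⟨⟨?_, ?_, h2.trans_lt hg⟩, h2⟩
  · filter_upwards [hc, hle] with ξ hξ hξ'
    exact ⟨(hξ.mono hIoo).aestronglyMeasurable measurableSet_Ioo, hξ'.trans_lt enorm_lt_top⟩
  · have h3 : AEMeasurable (fun ξ => ⨆ (q : ℚ) (_ : (q : ℝ) ∈ Set.Ioo 0 T), ‖w q ξ‖ₑ)
        gaussianSeq := by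
      refine AEMeasurable.iSup fun q => ?_
      by_cases hq : (q : ℝ) ∈ Set.Ioo 0 T
      · simp only [hq, iSup_pos]
        exact (hm q hq.1.le).enorm
      · simp only [hq, iSup_neg, not_false_iff]
        exact aemeasurable_const
    refine h3.congr ?_
    filter_upwards [hc] with ξ hξ using (linftyENorm_eq_iSup (hξ.mono hIoo)).symm

end Linfty

/-! ### The random potential -/

section Potential

variable {L : ℝ} [Fact (0 < L)] {v₀ : Sobolev L 1} {lam : ℕ → ℝ} {v : ℕ → Sobolev L 1}

lemma norm_term (hlam : ∀ j, 0 ≤ lam j) (ξ : ℕ → ℝ) (j : ℕ) :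
    ‖((lam j * ξ j : ℝ) : ℂ) • v j‖ = lam j * ‖v j‖ * |ξ j| := by
  rw [norm_smul, Complex.norm_real, norm_mul, Real.norm_of_nonneg (hlam j), Real.norm_eq_abs]
  ring

lemma norm_truncPotential_le (hlam : ∀ j, 0 ≤ lam j) {ξ : ℕ → ℝ}
    (hξ : Summable fun j => lam j * ‖v j‖ * |ξ j|) (m : ℕ) :
    ‖truncPotential v₀ lam v m ξ‖ ≤ ‖v₀‖ + absSum (fun j => lam j * ‖v j‖) ξ := by
  refine (norm_add_le _ _).trans (add_le_add_right ((norm_sum_le _ _).trans ?_) _)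
  simp only [norm_term hlam]
  exact hξ.sum_le_tsum _ fun j _ =>
    mul_nonneg (mul_nonneg (hlam j) (norm_nonneg _)) (abs_nonneg _)

lemma tendsto_truncPotential (hlam : ∀ j, 0 ≤ lam j) {ξ : ℕ → ℝ}
    (hξ : Summable fun j => lam j * ‖v j‖ * |ξ j|) :
    Tendsto (fun m => truncPotential v₀ lam v m ξ) atTop (𝓝 (potential v₀ lam v ξ)) := by
  have hs : Summable fun j => ((lam j * ξ j : ℝ) : ℂ) • v j :=
    Summable.of_norm (by simpa only [norm_term hlam] using hξ)
  exact hs.hasSum.tendsto_sum_nat.const_add v₀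

lemma norm_potential_le (hlam : ∀ j, 0 ≤ lam j) {ξ : ℕ → ℝ}
    (hξ : Summable fun j => lam j * ‖v j‖ * |ξ j|) :
    ‖potential v₀ lam v ξ‖ ≤ ‖v₀‖ + absSum (fun j => lam j * ‖v j‖) ξ :=
  le_of_tendsto' (tendsto_truncPotential hlam hξ).norm fun m => norm_truncPotential_le hlam hξ m

lemma stronglyMeasurable_truncPotential (m : ℕ) :
    StronglyMeasurable (truncPotential v₀ lam v m) := by
  have h : Continuous (truncPotential v₀ lam v m) := by
    unfold truncPotential
    fun_prop
  exact h.stronglyMeasurable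

lemma aestronglyMeasurable_potential (hlam : ∀ j, 0 ≤ lam j)
    (hs : Summable fun j => lam j * ‖v j‖) :
    AEStronglyMeasurable (potential v₀ lam v) gaussianSeq := by
  refine aestronglyMeasurable_of_tendsto_ae atTop (f := truncPotential v₀ lam v)
    (fun m => (stronglyMeasurable_truncPotential m).aestronglyMeasurable) ?_
  filter_upwards [ae_summable_abs (fun j => mul_nonneg (hlam j) (norm_nonneg (v j))) hs] with ξ hξ
  exact tendsto_truncPotential hlam hξ

end Potential

/-! ### Stability of random mild solutions -/

section Stability

variable {L : ℝ} [Fact (0 < L)] {ψin : Sobolev L 1} {a : ℕ → ℝ} {b : ℝ}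

lemma aestronglyMeasurable_of_isMildSolution {V : (ℕ → ℝ) → Sobolev L 1}
    (hV : AEStronglyMeasurable V gaussianSeq) {ψ : ℝ → (ℕ → ℝ) → Sobolev L 1}
    (hψ : ∀ᵐ ξ ∂gaussianSeq, IsMildSolution (V ξ) ψin (fun t => ψ t ξ)) {t : ℝ} (ht : 0 ≤ t) :
    AEStronglyMeasurable (ψ t) gaussianSeq := by
  refine ((continuous_solution ψin ht).comp_aestronglyMeasurable hV).congr ?_
  filter_upwards [hψ] with ξ hξ using (isMildSolution_solution ψin (V ξ)).eqOn hξ ht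

lemma IsMildSolution.norm_le_exp_absSum {V : Sobolev L 1} {ψ : ℝ → Sobolev L 1} {ξ : ℕ → ℝ}
    (h : IsMildSolution V ψin ψ) (hV : ‖V‖ ≤ b + absSum a ξ) {t T : ℝ} (ht : 0 ≤ t) (htT : t ≤ T) :
    ‖ψ t‖ ≤ ‖ψin‖ * Real.exp (‖Sobolev.mulL L‖ * (b + absSum a ξ) * T) := by
  have h0 := (norm_nonneg V).trans hV
  refine (h.norm_le ht).trans ?_
  gcongr

lemma IsMildSolution.norm_sub_le_exp_absSum {V₁ V₂ : Sobolev L 1} {ψ₁ ψ₂ : ℝ → Sobolev L 1}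
    {ξ : ℕ → ℝ} (h₁ : IsMildSolution V₁ ψin ψ₁) (h₂ : IsMildSolution V₂ ψin ψ₂)
    (hV₁ : ‖V₁‖ ≤ b + absSum a ξ) (hV₂ : ‖V₂‖ ≤ b + absSum a ξ) {t T : ℝ} (ht : 0 ≤ t)
    (htT : t ≤ T) :
    ‖ψ₁ t - ψ₂ t‖ ≤ T * ‖ψin‖ * ‖Sobolev.mulL L‖ *
      Real.exp (2 * ‖Sobolev.mulL L‖ * (b + absSum a ξ) * T) * ‖V₁ - V₂‖ := by
  have h0 := (norm_nonneg V₁).trans hV₁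
  have h3 : ‖Sobolev.mulL L‖ * (‖V₁‖ + ‖V₂‖) * t ≤
      2 * ‖Sobolev.mulL L‖ * (b + absSum a ξ) * T := by
    calc ‖Sobolev.mulL L‖ * (‖V₁‖ + ‖V₂‖) * t ≤
        ‖Sobolev.mulL L‖ * ((b + absSum a ξ) + (b + absSum a ξ)) * T := by gcongr
      _ = _ := by ring
  have hT : 0 ≤ T := ht.trans htT
  calc ‖ψ₁ t - ψ₂ t‖ ≤ t * ‖ψin‖ * (‖Sobolev.mulL L‖ * ‖V₁ - V₂‖) *
        Real.exp (‖Sobolev.mulL L‖ * (‖V₁‖ + ‖V₂‖) * t) := h₁.norm_sub_le h₂ ht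
    _ ≤ T * ‖ψin‖ * (‖Sobolev.mulL L‖ * ‖V₁ - V₂‖) *
        Real.exp (2 * ‖Sobolev.mulL L‖ * (b + absSum a ξ) * T) := by gcongr
    _ = _ := by ring

/-- Stability of the random solution in `L²_μ(U, L^∞((0,T), H¹(𝕋)))`, uniformly over potentials with
a common majorant. -/
lemma exists_lqLinfty_sub_le (ψin : Sobolev L 1) (ha : ∀ j, 0 ≤ a j) (hs : Summable a) (b : ℝ)
    {ε : ℝ} (hε : 0 < ε) (T : ℝ) :
    ∃ C : ℝ, 0 < C ∧ ∀ (V₁ V₂ : (ℕ → ℝ) → Sobolev L 1) (ψ₁ ψ₂ : ℝ → (ℕ → ℝ) → Sobolev L 1) (δ : ℝ),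
      AEStronglyMeasurable V₁ gaussianSeq → AEStronglyMeasurable V₂ gaussianSeq →
      (∀ᵐ ξ ∂gaussianSeq, ‖V₁ ξ‖ ≤ b + absSum a ξ) →
      (∀ᵐ ξ ∂gaussianSeq, ‖V₂ ξ‖ ≤ b + absSum a ξ) →
      (∀ᵐ ξ ∂gaussianSeq, IsMildSolution (V₁ ξ) ψin (fun t => ψ₁ t ξ)) →
      (∀ᵐ ξ ∂gaussianSeq, IsMildSolution (V₂ ξ) ψin (fun t => ψ₂ t ξ)) →
      eLpNorm (fun ξ => V₁ ξ - V₂ ξ) (ENNReal.ofReal (2 + ε)) gaussianSeq ≤ ENNReal.ofReal δ →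
      MemLqLinfty 2 T (fun t ξ => ψ₁ t ξ - ψ₂ t ξ) ∧
        lqLinftyENorm 2 T (fun t ξ => ψ₁ t ξ - ψ₂ t ξ) ≤ ENNReal.ofReal (C * δ) := by
  set κ := ‖Sobolev.mulL L‖
  obtain ⟨C, hC, hbound⟩ := exists_eLpNorm_exp_smul_le (E := Sobolev L 1) ha hs hε
    (T * ‖ψin‖ * κ * Real.exp (2 * κ * b * T)) (2 * κ * T)
  refine ⟨C, hC, fun V₁ V₂ ψ₁ ψ₂ δ hV₁ hV₂ hb₁ hb₂ h₁ h₂ hδ => ?_⟩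
  have hg := hbound _ δ (hV₁.sub hV₂) hδ
  have h := memLqLinfty_two (T := T) (w := fun t ξ => ψ₁ t ξ - ψ₂ t ξ)
    (g := fun ξ => (T * ‖ψin‖ * κ * Real.exp (2 * κ * b * T) *
      Real.exp (2 * κ * T * absSum a ξ)) • (V₁ - V₂) ξ) ?_ ?_ ?_ (hg.trans_lt ENNReal.ofReal_lt_top)
  · exact ⟨h.1, h.2.trans hg⟩
  · filter_upwards [h₁, h₂] with ξ hξ₁ hξ₂ using hξ₁.1.sub hξ₂.1
  · exact fun t ht => (aestronglyMeasurable_of_isMildSolution hV₁ h₁ ht).sub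
      (aestronglyMeasurable_of_isMildSolution hV₂ h₂ ht)
  · filter_upwards [h₁, h₂, hb₁, hb₂] with ξ hξ₁ hξ₂ hbξ₁ hbξ₂ t ht
    have hT : 0 ≤ T := ht.1.trans ht.2
    have h3 := hξ₁.norm_sub_le_exp_absSum hξ₂ hbξ₁ hbξ₂ ht.1 ht.2
    rw [norm_smul, Real.norm_of_nonneg (by positivity), Pi.sub_apply,
      mul_assoc _ (Real.exp _) (Real.exp _), ← Real.exp_add]
    refine h3.trans_eq ?_
    congr 3
    ring

/-- The position density is quadratic in the solution, hence bounded by an exponential of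
`∑ⱼ aⱼ |ξⱼ|`. -/
lemma integrable_density (G : Sobolev L 1 →L[ℂ] ℂ) (ha : ∀ j, 0 ≤ a j) (hs : Summable a)
    {V : (ℕ → ℝ) → Sobolev L 1} (hV : AEStronglyMeasurable V gaussianSeq)
    (hb : ∀ᵐ ξ ∂gaussianSeq, ‖V ξ‖ ≤ b + absSum a ξ) {ψ : ℝ → (ℕ → ℝ) → Sobolev L 1}
    (h : ∀ᵐ ξ ∂gaussianSeq, IsMildSolution (V ξ) ψin (fun t => ψ t ξ)) {t : ℝ} (ht : 0 ≤ t) :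
    Integrable (fun ξ => G (ψ t ξ).density) gaussianSeq := by
  set κ := ‖Sobolev.mulL L‖
  have hi := (integrable_exp_absSum ha hs (2 * κ * t)).const_mul
    (‖G‖ * κ * ‖ψin‖ ^ 2 * Real.exp (2 * κ * b * t))
  refine hi.mono' ((G.continuous.comp Sobolev.continuous_density).comp_aestronglyMeasurable
    (aestronglyMeasurable_of_isMildSolution hV h ht)) ?_
  filter_upwards [h, hb] with ξ hξ hbξ
  have h1 := hξ.norm_le_exp_absSum hbξ ht le_rfl
  calc ‖G (ψ t ξ).density‖ ≤ ‖G‖ * (κ * ‖ψ t ξ‖ ^ 2) :=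
        (G.le_opNorm _).trans (by gcongr; exact Sobolev.norm_density_le _)
    _ ≤ ‖G‖ * (κ * (‖ψin‖ * Real.exp (κ * (b + absSum a ξ) * t)) ^ 2) := by gcongr
    _ = ‖G‖ * κ * ‖ψin‖ ^ 2 * Real.exp (2 * κ * b * t) * Real.exp (2 * κ * t * absSum a ξ) := by
        rw [mul_pow, ← Real.exp_nat_mul, mul_assoc _ (Real.exp _) (Real.exp _), ← Real.exp_add]
        push_cast
        ring_nf

/-- Stability of the expectation of linear functionals of the position density, uniformly over
potentials with a common majorant. -/
lemma exists_norm_integral_density_sub_le (ψin : Sobolev L 1) (G : Sobolev L 1 →L[ℂ] ℂ)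
    (ha : ∀ j, 0 ≤ a j) (hs : Summable a) (b : ℝ) {ε : ℝ} (hε : 0 < ε) (T : ℝ) :
    ∃ C : ℝ, 0 < C ∧ ∀ (V₁ V₂ : (ℕ → ℝ) → Sobolev L 1) (ψ₁ ψ₂ : ℝ → (ℕ → ℝ) → Sobolev L 1) (δ : ℝ),
      0 ≤ δ →
      AEStronglyMeasurable V₁ gaussianSeq → AEStronglyMeasurable V₂ gaussianSeq →
      (∀ᵐ ξ ∂gaussianSeq, ‖V₁ ξ‖ ≤ b + absSum a ξ) →
      (∀ᵐ ξ ∂gaussianSeq, ‖V₂ ξ‖ ≤ b + absSum a ξ) →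
      (∀ᵐ ξ ∂gaussianSeq, IsMildSolution (V₁ ξ) ψin (fun t => ψ₁ t ξ)) →
      (∀ᵐ ξ ∂gaussianSeq, IsMildSolution (V₂ ξ) ψin (fun t => ψ₂ t ξ)) →
      eLpNorm (fun ξ => V₁ ξ - V₂ ξ) (ENNReal.ofReal (2 + ε)) gaussianSeq ≤ ENNReal.ofReal δ →
      ∀ t, 0 ≤ t → t ≤ T →
        ‖(∫ ξ, G (ψ₁ t ξ).density ∂gaussianSeq) - ∫ ξ, G (ψ₂ t ξ).density ∂gaussianSeq‖ ≤
          C * δ := by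
  set κ := ‖Sobolev.mulL L‖
  obtain ⟨C, hC, hbound⟩ := exists_eLpNorm_exp_smul_le (E := Sobolev L 1) ha hs hε
    (2 * ‖G‖ * κ ^ 2 * T * ‖ψin‖ ^ 2 * Real.exp (3 * κ * b * T)) (3 * κ * T)
  refine ⟨C, hC, fun V₁ V₂ ψ₁ ψ₂ δ hδ0 hV₁ hV₂ hb₁ hb₂ h₁ h₂ hδ t ht htT => ?_⟩
  have hg := hbound _ δ (hV₁.sub hV₂) hδ
  have hT : 0 ≤ T := ht.trans htT
  set g : (ℕ → ℝ) → Sobolev L 1 := fun ξ =>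
    (2 * ‖G‖ * κ ^ 2 * T * ‖ψin‖ ^ 2 * Real.exp (3 * κ * b * T) *
      Real.exp (3 * κ * T * absSum a ξ)) • (V₁ - V₂) ξ with hg_def
  have hgm : AEStronglyMeasurable g gaussianSeq :=
    (((measurable_absSum ha).const_mul _).exp.const_mul _).aestronglyMeasurable.smul (hV₁.sub hV₂)
  have hpt : ∀ᵐ ξ ∂gaussianSeq, ‖G (ψ₁ t ξ).density - G (ψ₂ t ξ).density‖ₑ ≤ ‖g ξ‖ₑ := by
    filter_upwards [h₁, h₂, hb₁, hb₂] with ξ hξ₁ hξ₂ hbξ₁ hbξ₂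
    refine enorm_le_iff_norm_le.mpr ?_
    have n₁ := hξ₁.norm_le_exp_absSum hbξ₁ ht htT
    have n₂ := hξ₂.norm_le_exp_absSum hbξ₂ ht htT
    have n₃ := hξ₁.norm_sub_le_exp_absSum hξ₂ hbξ₁ hbξ₂ ht htT
    set e := Real.exp (κ * (b + absSum a ξ) * T)
    have e3 : Real.exp (3 * κ * b * T) * Real.exp (3 * κ * T * absSum a ξ) =
        e * Real.exp (2 * κ * (b + absSum a ξ) * T) := by
      rw [← Real.exp_add, ← Real.exp_add]
      ring_nf
    rw [← map_sub]
    calc ‖G ((ψ₁ t ξ).density - (ψ₂ t ξ).density)‖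
        ≤ ‖G‖ * (κ * (‖ψ₁ t ξ‖ + ‖ψ₂ t ξ‖) * ‖ψ₁ t ξ - ψ₂ t ξ‖) :=
          (G.le_opNorm _).trans (by gcongr; exact Sobolev.norm_density_sub_le _ _)
      _ ≤ ‖G‖ * (κ * (‖ψin‖ * e + ‖ψin‖ * e) * (T * ‖ψin‖ * κ *
            Real.exp (2 * κ * (b + absSum a ξ) * T) * ‖V₁ ξ - V₂ ξ‖)) := by gcongr
      _ = 2 * ‖G‖ * κ ^ 2 * T * ‖ψin‖ ^ 2 * (e * Real.exp (2 * κ * (b + absSum a ξ) * T)) *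
            ‖V₁ ξ - V₂ ξ‖ := by ring
      _ = ‖g ξ‖ := by
        rw [hg_def]
        simp only
        rw [norm_smul, Real.norm_of_nonneg (by positivity), Pi.sub_apply,
          mul_assoc _ (Real.exp _) (Real.exp _), e3]
  rw [← integral_sub (integrable_density G ha hs hV₁ hb₁ h₁ ht)
    (integrable_density G ha hs hV₂ hb₂ h₂ ht)]
  have h4 : ‖∫ ξ, (G (ψ₁ t ξ).density - G (ψ₂ t ξ).density) ∂gaussianSeq‖ₑ ≤
      ENNReal.ofReal (C * δ) :=
    calc _ ≤ ∫⁻ ξ, ‖G (ψ₁ t ξ).density - G (ψ₂ t ξ).density‖ₑ ∂gaussianSeq :=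
          enorm_integral_le_lintegral_enorm _
      _ ≤ ∫⁻ ξ, ‖g ξ‖ₑ ∂gaussianSeq := lintegral_mono_ae hpt
      _ = eLpNorm g 1 gaussianSeq := eLpNorm_one_eq_lintegral_enorm.symm
      _ ≤ eLpNorm g 2 gaussianSeq := eLpNorm_le_eLpNorm_of_exponent_le (by norm_num) hgm
      _ ≤ ENNReal.ofReal (C * δ) := hg
  rw [← ofReal_norm] at h4
  exact (ENNReal.ofReal_le_ofReal_iff (mul_nonneg hC.le hδ0)).mp h4

end Stability

end RandomSchrodinger

end

theorem mainTheorem5 (L : ℝ) [Fact (0 < L)] (s : ℝ) (hs : 1 ≤ s)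
    (ψin v₀ : Sobolev L s) (v : ℕ → Sobolev L s)
    (lam : ℕ → ℝ) (hlam_pos : ∀ j, 0 < lam j) (hlam_anti : Antitone lam)
    (hv₀_real : v₀.IsReal) (hv_real : ∀ j, (v j).IsReal)
    (hvW : ∀ j, MemW1inf (v j))
    (G : Sobolev L 1 →L[ℂ] ℂ)
    (ha : Summable fun j => lam j * ‖v j‖)
    (p : ℝ) (hp_pos : 0 < p) (hp_le : p ≤ 1)
    (hb : Summable fun j => (lam j * w1infNorm (v j)) ^ p)
    (V : (ℕ → ℝ) → Sobolev L 1)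
    (hV : V = potential (v₀.incl hs) lam (fun j => (v j).incl hs))
    (Vm : ℕ → (ℕ → ℝ) → Sobolev L 1)
    (hVm : Vm = truncPotential (v₀.incl hs) lam (fun j => (v j).incl hs))
    (CV ε χ : ℝ) (hCV : 0 < CV) (hε : 0 < ε) (hχ : 0 < χ)
    (hconv : ∀ m : ℕ, 1 ≤ m →
      eLpNorm (fun ξ => Vm m ξ - V ξ) (ENNReal.ofReal (2 + ε)) gaussianSeq
        ≤ ENNReal.ofReal (CV * (m : ℝ) ^ (-χ))) :
    (∀ᵐ ξ ∂gaussianSeq,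
      WellPosed (V ξ) (ψin.incl hs) ∧
        ∀ m : ℕ, 1 ≤ m → WellPosed (Vm m ξ) (ψin.incl hs)) ∧
    ∀ (ψ : ℝ → (ℕ → ℝ) → Sobolev L 1)
      (ψm : ℕ → ℝ → (ℕ → ℝ) → Sobolev L 1),
      (∀ᵐ ξ ∂gaussianSeq,
        IsMildSolution (V ξ) (ψin.incl hs) (fun t => ψ t ξ)) →
      (∀ m : ℕ, 1 ≤ m → ∀ᵐ ξ ∂gaussianSeq,
        IsMildSolution (Vm m ξ) (ψin.incl hs) (fun t => ψm m t ξ)) →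
      ∀ T : ℝ, 0 < T →
        (∃ C : ℝ, 0 < C ∧ ∀ m : ℕ, 1 ≤ m →
          MemLqLinfty 2 T (fun t ξ => ψm m t ξ - ψ t ξ) ∧
          lqLinftyENorm 2 T (fun t ξ => ψm m t ξ - ψ t ξ)
            ≤ ENNReal.ofReal (C * (m : ℝ) ^ (-χ))) ∧
        (∃ C : ℝ, 0 < C ∧ ∀ m : ℕ, 1 ≤ m → ∀ t : ℝ, 0 ≤ t → t ≤ T →
          Integrable (fun ξ => G (ψ t ξ).density) gaussianSeq ∧
          Integrable (fun ξ => G (ψm m t ξ).density) gaussianSeq ∧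
          ‖(∫ ξ, G (ψ t ξ).density ∂gaussianSeq) -
              ∫ ξ, G (ψm m t ξ).density ∂gaussianSeq‖
            ≤ C * (m : ℝ) ^ (-χ)) := by
  have hlam : ∀ j, 0 ≤ lam j := fun j => (hlam_pos j).le
  have ha_nonneg : ∀ j, 0 ≤ lam j * ‖(v j).incl hs‖ := fun j =>
    mul_nonneg (hlam j) (norm_nonneg _)
  have ha_sum : Summable fun j => lam j * ‖(v j).incl hs‖ :=
    ha.of_nonneg_of_le ha_nonneg fun j =>
      mul_le_mul_of_nonneg_left (Sobolev.norm_incl_le hs (v j)) (hlam j)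
  have hV_meas : AEStronglyMeasurable V gaussianSeq :=
    hV ▸ aestronglyMeasurable_potential hlam ha_sum
  have hVm_meas : ∀ m, AEStronglyMeasurable (Vm m) gaussianSeq := fun m =>
    hVm ▸ (stronglyMeasurable_truncPotential m).aestronglyMeasurable
  have hV_le : ∀ᵐ ξ ∂gaussianSeq,
      ‖V ξ‖ ≤ ‖v₀.incl hs‖ + absSum (fun j => lam j * ‖(v j).incl hs‖) ξ := by
    filter_upwards [ae_summable_abs ha_nonneg ha_sum] with ξ hξ
    exact hV ▸ norm_potential_le hlam hξ
  have hVm_le : ∀ m, ∀ᵐ ξ ∂gaussianSeq,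
      ‖Vm m ξ‖ ≤ ‖v₀.incl hs‖ + absSum (fun j => lam j * ‖(v j).incl hs‖) ξ := by
    intro m
    filter_upwards [ae_summable_abs ha_nonneg ha_sum] with ξ hξ
    exact hVm ▸ norm_truncPotential_le hlam hξ m
  refine ⟨ae_of_all _ fun ξ => ⟨wellPosed _ _, fun m _ => wellPosed _ _⟩,
    fun ψ ψm hψ hψm T _ => ⟨?_, ?_⟩⟩
  · obtain ⟨C, hC, h⟩ := exists_lqLinfty_sub_le (ψin.incl hs) ha_nonneg ha_sum ‖v₀.incl hs‖ hε T
    refine ⟨C * CV, by positivity, fun m hm => ?_⟩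
    rw [mul_assoc]
    exact h (Vm m) V (ψm m) ψ _ (hVm_meas m) hV_meas (hVm_le m) hV_le (hψm m hm) hψ (hconv m hm)
  · obtain ⟨C, hC, h⟩ := exists_norm_integral_density_sub_le (ψin.incl hs) G ha_nonneg ha_sum
      ‖v₀.incl hs‖ hε T
    refine ⟨C * CV, by positivity, fun m hm t ht htT => ⟨?_, ?_, ?_⟩⟩
    · exact integrable_density G ha_nonneg ha_sum hV_meas hV_le hψ ht
    · exact integrable_density G ha_nonneg ha_sum (hVm_meas m) (hVm_le m) (hψm m hm) ht
    · rw [mul_assoc, norm_sub_rev]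
      exact h (Vm m) V (ψm m) ψ _ (by positivity) (hVm_meas m) hV_meas (hVm_le m) hV_le (hψm m hm)
        hψ (hconv m hm) t ht htT
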